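/- **Parameters.** A spheroid parameter is a number $\mu\in[0,1)\cup i\mathbb{R}^+$, where $i\mathbb R^+=\{ia: a>0\}$ ($\mu=0$: the ball; $0<\mu<1$: prolate; $\mu\in i\mathbb{R}^+$: oblate). Write $x=(x_0,x_1,x_2)\in\mathbb{R}^3$, $\rho=\sqrt{x_1^2+x_2^2}$, and let $\phi$ be the polar angle of $(x_1,x_2)$. For $\mu\ne0$ the spheroidal coordinates $(u,v)$ of $x$ are given by $$x_0=\mu\cos u\cosh v,\qquad \rho=\mu\sin u\sinh v,\qquad u\in[0,\pi],$$ with $v\in[0,\infty)$ if $\mu$ is real and $v\in[0,\infty)-i\pi/2$ if $\mu\in i\mathbb{R}^+$. **Harmonics.** Let $(a)_j=a(a+1)\cdots(a+j-1)$, let $P_n$ be the Legendre polynomials, and let $P_n^m(t)=(-1)^m(1-t^2)^{m/2}P_n^{(m)}(t)$ for $t\in[-1,1]$ and $P_n^m(\cosh v)=(\sinh v)^mP_n^{(m)}(\cosh v)$ for the arguments $\cosh v$ above. Put $$U_{n,m}[\mu]=\frac{(n-m)!}{2^n(1/2)_n}\,\mu^n P_n^m(\cos u)P_n^m(\cosh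 v)\quad(\mu\neq0),\qquad U_{n,m}[0]=|x|^nP_n^m(x_0/|x|),$$ $\Phi^+_m(\phi)=\cos m\phi$, $\Phi_m^-(\phi)=\sin m\phi$, and $U^\pm_{n,m}[\mu](x)=U_{n,m}[\mu]\,\Phi^\pm_m(\phi)$; the sign $-$ is used only for $m\ge1$. The Garabedian spheroidal harmonics are $$V^\pm_{n,m}[\mu]=\frac{\partial}{\partial x_0}U^\pm_{n+1,m}[\mu]=V_{n,m}[\mu]\,\Phi_m^\pm(\phi),$$ where $V_{n,m}[\mu]=\partial U_{n+1,m}[\mu]/\partial x_0$ is a function of $(x_0,\rho)$ only. All these functions are considered on the whole of $\mathbb{R}^3$. **Theorem.** Let $n\ge0$, $0\le m\le n$, and let $\mu,\tilde\mu\in[0,1)\cup i\mathbb{R}^+$ with $\mu\ne0$. Then there are unique coefficients $v_{n,m,k}[\tilde\mu,\mu]$ ($0\le 2k\le n-m$) such that $$V_{n,m}[\tilde\mu]=\sum_{0\le2k\le n-m}v_{n,m,k}[\tilde\mu,\mu]\,V_{n-2k,m}[\mu]$$ as functions of $(x_0,\rho)$, $x_0\in\mathbb{R}$, $\rho\ge0$,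 and they are $$v_{n,m,k}[\tilde\mu,\mu]={}_2F_1\!\left(-k,\,-n+k-\tfrac32;\,-n-\tfrac12;\,(\tilde\mu/\mu)^2\right)\frac{(n+m+1)!\,(1/2)_{n-2k+2}}{4^k\,k!\,(n+m-2k+1)!\,(1/2)_{n-k+2}}\;\mu^{2k},$$ where ${}_2F_1$ is the Gaussian hypergeometric function. Likewise, for each sign $\pm$ (with $m\ge1$ for the sign $-$), these are the unique coefficients for which $V^\pm_{n,m}[\tilde\mu](x)=\sum_{0\le2k\le n-m}v_{n,m,k}[\tilde\mu,\mu]\,V^\pm_{n-2k,m}[\mu](x)$ for all $x\in\mathbb{R}^3$. -/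

import Mathlib

noncomputable section

namespace SpheroidalHarmonics

open Polynomial

/-- The admissible spheroid parameters `μ ∈ [0,1) ∪ iℝ⁺`: `μ = 0` is the unit ball,
`0 < μ < 1` the prolate spheroids, `μ = i a` with `a > 0` the oblate ones. -/
def IsSpheroidParameter (μ : ℂ) : Prop :=
  (∃ a : ℝ, 0 ≤ a ∧ a < 1 ∧ μ = (a : ℂ)) ∨ (∃ a : ℝ, 0 < a ∧ μ = (a : ℂ) * Complex.I)

/-- The Legendre polynomial `P_n` (Rodrigues' formula). -/
def legendre (n : ℕ) : ℝ[X] :=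
  C (1 / (2 ^ n * (n.factorial : ℝ))) * derivative^[n] ((X ^ 2 - 1) ^ n)

/-- The associated Legendre function on `[-1,1]`:
`P_n^m(t) = (-1)^m (1-t²)^{m/2} (d/dt)^m P_n(t)`. -/
def assocLegendre (n m : ℕ) (t : ℝ) : ℝ :=
  (-1) ^ m * √(1 - t ^ 2) ^ m * (derivative^[m] (legendre n)).eval t

/-- The associated Legendre function off the cut, `P_n^m(z) = (z²-1)^{m/2} (d/dz)^m P_n(z)`,
at `z = cosh v`, the square root of `z²-1` being `sinh v`. -/
def assocLegendreCosh (n m : ℕ) (v : ℂ) : ℂ :=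
  Complex.sinh v ^ m * aeval (Complex.cosh v) (derivative^[m] (legendre n))

/-- `(u, v)` are spheroidal coordinates of the point of the meridian half-plane at height `x₀`
and distance `ρ` from the axis: `x₀ = μ cos u cosh v`, `ρ = μ sin u sinh v`, with `u ∈ [0,π]`.
In the prolate case `v ∈ [0,∞)`; in the oblate case `v ∈ [0,∞) - iπ/2`, that is, for `μ = i a` and
`v = w - iπ/2`, the usual `x₀ = a cos u sinh w`, `ρ = a sin u cosh w` with `w ≥ 0`. -/
def IsSpheroidalCoord (μ : ℂ) (x₀ ρ u : ℝ) (v : ℂ) : Prop :=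
  u ∈ Set.Icc 0 Real.pi ∧ 0 ≤ v.re ∧ v.im = (if μ.im = 0 then 0 else -(Real.pi / 2)) ∧
    (x₀ : ℂ) = μ * Complex.cos u * Complex.cosh v ∧ (ρ : ℂ) = μ * Complex.sin u * Complex.sinh v

/-- The factor `U_{n,m}[μ](u,v) = (n-m)! / (2^n (1/2)_n) μ^n P_n^m(cos u) P_n^m(cosh v)`. -/
def harmonicUCoord (n m : ℕ) (μ : ℂ) (u : ℝ) (v : ℂ) : ℂ :=
  ((n - m).factorial : ℂ) / (2 ^ n * (ascPochhammer ℂ n).eval (1 / 2)) * μ ^ n *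
    (assocLegendre n m (Real.cos u) : ℂ) * assocLegendreCosh n m v

open Classical in
/-- The factor `U_{n,m}[μ]`, not depending on the angle `φ`, of the solid spheroidal harmonics,
as a function of the height `x₀` and the distance `ρ ≥ 0` from the axis. For `μ ≠ 0` it is the
product of Legendre functions above, in spheroidal coordinates of the point (see
`exists_isSpheroidalCoord`, `harmonicU_eq`); for `μ = 0` it is `|x|^n P_n^m(x₀/|x|)`. -/
def harmonicU (n m : ℕ) (μ : ℂ) (x₀ ρ : ℝ) : ℂ :=
  if μ = 0 then
    ((√(x₀ ^ 2 + ρ ^ 2) ^ n * assocLegendre n m (x₀ / √(x₀ ^ 2 + ρ ^ 2)) : ℝ) : ℂ)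
  else if h : ∃ p : ℝ × ℂ, IsSpheroidalCoord μ x₀ ρ p.1 p.2 then
    harmonicUCoord n m μ h.choose.1 h.choose.2
  else 0

/-- `Φ_m^+(φ) = cos (mφ)` (`true`) and `Φ_m^-(φ) = sin (mφ)` (`false`). -/
def angular (sign : Bool) (m : ℕ) (φ : ℝ) : ℝ :=
  if sign then Real.cos (m * φ) else Real.sin (m * φ)

/-- The solid harmonics `U^±_{n,m}[μ](x) = U_{n,m}[μ] Φ_m^±(φ)`, where `φ` is the polar angle of
`(x₁, x₂)`. -/
def solidU (sign : Bool) (n m : ℕ) (μ : ℂ) (x₀ x₁ x₂ : ℝ) : ℂ :=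
  harmonicU n m μ x₀ √(x₁ ^ 2 + x₂ ^ 2) * (angular sign m (Complex.arg ⟨x₁, x₂⟩) : ℂ)

/-- The Garabedian spheroidal harmonics `V^±_{n,m}[μ] = ∂/∂x₀ U^±_{n+1,m}[μ]`. -/
def solidV (sign : Bool) (n m : ℕ) (μ : ℂ) (x₀ x₁ x₂ : ℝ) : ℂ :=
  deriv (fun s : ℝ => solidU sign (n + 1) m μ s x₁ x₂) x₀

/-- The factor `V_{n,m}[μ]` of `V^±_{n,m}[μ] = V_{n,m}[μ] Φ_m^±(φ)` (see
`solidV_eq_garabedianV_mul_angular`), as a function of height `x₀` and distance `ρ`. -/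
def garabedianV (n m : ℕ) (μ : ℂ) (x₀ ρ : ℝ) : ℂ :=
  deriv (fun s : ℝ => harmonicU (n + 1) m μ s ρ) x₀

/-- `(n+m+1)! (1/2)_{n-2k+2} / (4^k k! (n+m-2k+1)! (1/2)_{n-k+2})`; used only for `2k ≤ n-m`. -/
def conversionConstant (n m k : ℕ) : ℂ :=
  ((n + m + 1).factorial : ℂ) * (ascPochhammer ℂ (n - 2 * k + 2)).eval (1 / 2) /
    (4 ^ k * (k.factorial : ℂ) * ((n + m - 2 * k + 1).factorial : ℂ) *
      (ascPochhammer ℂ (n - k + 2)).eval (1 / 2))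

/-- `₂F₁(-k, -n+k-3/2; -n-1/2; (μ'/μ)²)` times the constant above times `μ^{2k}`. -/
def conversionCoeff (n m k : ℕ) (μ' μ : ℂ) : ℂ :=
  ordinaryHypergeometric (-(k : ℂ)) (-(n : ℂ) + k - 3 / 2) (-(n : ℂ) - 1 / 2) ((μ' / μ) ^ 2) *
    conversionConstant n m k * μ ^ (2 * k)

theorem solidV_eq_garabedianV_mul_angular (sign : Bool) (n m : ℕ) (μ : ℂ) (x₀ x₁ x₂ : ℝ) :
    solidV sign n m μ x₀ x₁ x₂ =
      garabedianV n m μ x₀ √(x₁ ^ 2 + x₂ ^ 2) * (angular sign m (Complex.arg ⟨x₁, x₂⟩) : ℂ) := by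
  simp only [solidV, garabedianV, solidU]
  exact deriv_mul_const_field _

/-- Reduction of an angle modulo `2π`. -/
theorem exists_angle (a : ℝ) :
    ∃ b : ℝ, -Real.pi < b ∧ b ≤ Real.pi ∧ Real.cos b = Real.cos a ∧ Real.sin b = Real.sin a := by
  refine ⟨toIocMod Real.two_pi_pos (-Real.pi) a, ?_, ?_, ?_, ?_⟩
  · exact (toIocMod_mem_Ioc Real.two_pi_pos (-Real.pi) a).1
  · have := (toIocMod_mem_Ioc Real.two_pi_pos (-Real.pi) a).2
    linarith
  · rw [toIocMod, zsmul_eq_mul, Real.cos_sub_int_mul_two_pi]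
  · rw [toIocMod, zsmul_eq_mul, Real.sin_sub_int_mul_two_pi]

theorem mem_Icc_of_sin_nonneg {b : ℝ} (h1 : -Real.pi < b) (h2 : b ≤ Real.pi)
    (h : 0 ≤ Real.sin b) : b ∈ Set.Icc 0 Real.pi := by
  refine ⟨?_, h2⟩
  by_contra hb
  exact absurd (Real.sin_neg_of_neg_of_neg_pi_lt (not_le.1 hb) h1) (not_lt.2 h)

/-- Every point `(x, ρ)` with `ρ ≥ 0` is `(cos u sinh w, sin u cosh w)`. -/
theorem exists_sin_coords (x ρ : ℝ) (hρ : 0 ≤ ρ) :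
    ∃ u w : ℝ, u ∈ Set.Icc 0 Real.pi ∧ 0 ≤ w ∧ x = Real.cos u * Real.sinh w ∧
      ρ = Real.sin u * Real.cosh w := by
  obtain ⟨ζ, hζ⟩ := Complex.sin_surjective ⟨ρ, x⟩
  have h := Complex.sin_eq ζ
  rw [hζ] at h
  have hre : ρ = Real.sin ζ.re * Real.cosh ζ.im := by
    have := congrArg Complex.re h
    simpa [← Complex.ofReal_sin, ← Complex.ofReal_cosh, ← Complex.ofReal_cos,
      ← Complex.ofReal_sinh] using this
  have him : x = Real.cos ζ.re * Real.sinh ζ.im := by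
    have := congrArg Complex.im h
    simpa [← Complex.ofReal_sin, ← Complex.ofReal_cosh, ← Complex.ofReal_cos,
      ← Complex.ofReal_sinh] using this
  obtain ⟨b, hb1, hb2, hc, hs⟩ := exists_angle ζ.re
  rw [← hc] at him
  rw [← hs] at hre
  have hpos := Real.cosh_pos ζ.im
  have hsin : 0 ≤ Real.sin b := by
    by_contra hneg
    nlinarith [mul_neg_of_neg_of_pos (not_le.1 hneg) hpos]
  have hb := mem_Icc_of_sin_nonneg hb1 hb2 hsin
  rcases le_total 0 ζ.im with hq | hq
  · exact ⟨b, ζ.im, hb, hq, him, hre⟩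
  · refine ⟨Real.pi - b, -ζ.im, ⟨by linarith [hb.2], by linarith [hb.1]⟩, by linarith, ?_, ?_⟩
    · rw [Real.cos_pi_sub, Real.sinh_neg, him]; ring
    · rw [Real.sin_pi_sub, Real.cosh_neg, hre]

/-- Every point `(x, ρ)` with `ρ ≥ 0` is `(cos u cosh w, sin u sinh w)`. -/
theorem exists_cos_coords (x ρ : ℝ) (hρ : 0 ≤ ρ) :
    ∃ u w : ℝ, u ∈ Set.Icc 0 Real.pi ∧ 0 ≤ w ∧ x = Real.cos u * Real.cosh w ∧
      ρ = Real.sin u * Real.sinh w := by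
  obtain ⟨ζ, hζ⟩ := Complex.cos_surjective ⟨x, ρ⟩
  have h := Complex.cos_eq ζ
  rw [hζ] at h
  have hre : x = Real.cos ζ.re * Real.cosh ζ.im := by
    have := congrArg Complex.re h
    simpa [← Complex.ofReal_sin, ← Complex.ofReal_cosh, ← Complex.ofReal_cos,
      ← Complex.ofReal_sinh] using this
  have him : ρ = -(Real.sin ζ.re * Real.sinh ζ.im) := by
    have := congrArg Complex.im h
    simpa [← Complex.ofReal_sin, ← Complex.ofReal_cosh, ← Complex.ofReal_cos,
      ← Complex.ofReal_sinh] using this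
  obtain ⟨b, hb1, hb2, hc, hs⟩ := exists_angle ζ.re
  rw [← hc] at hre
  rw [← hs] at him
  have habs : ρ = |Real.sin b| * Real.sinh |ζ.im| := by
    rw [← Real.abs_sinh, ← abs_mul, ← abs_neg, ← him, abs_of_nonneg hρ]
  have hcosh : x = Real.cos b * Real.cosh |ζ.im| := by rw [Real.cosh_abs, hre]
  rcases le_total 0 (Real.sin b) with h0 | h0
  · exact ⟨b, |ζ.im|, mem_Icc_of_sin_nonneg hb1 hb2 h0, abs_nonneg _, hcosh,
      by rw [habs, abs_of_nonneg h0]⟩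
  · refine ⟨|b|, |ζ.im|, ⟨abs_nonneg _, abs_le.2 ⟨hb1.le, hb2⟩⟩, abs_nonneg _, ?_, ?_⟩
    · rw [Real.cos_abs, hcosh]
    · rw [habs]
      congr 1
      rw [abs_of_nonpos h0]
      rcases le_total 0 b with hb | hb
      · have := Real.sin_nonneg_of_nonneg_of_le_pi hb hb2
        rw [abs_of_nonneg hb]; linarith
      · rw [abs_of_nonpos hb, Real.sin_neg]

/-- Spheroidal coordinates exist at every point. -/
theorem exists_isSpheroidalCoord {μ : ℂ} (hμ : IsSpheroidParameter μ) (h0 : μ ≠ 0) (x₀ ρ : ℝ)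
    (hρ : 0 ≤ ρ) : ∃ p : ℝ × ℂ, IsSpheroidalCoord μ x₀ ρ p.1 p.2 := by
  rcases hμ with ⟨a, ha, -, rfl⟩ | ⟨a, ha, rfl⟩
  · have ha' : a ≠ 0 := fun h => h0 (by simp [h])
    obtain ⟨u, w, hu, hw, h1, h2⟩ := exists_cos_coords (x₀ / a) (ρ / a) (by positivity)
    refine ⟨(u, (w : ℂ)), hu, by simpa using hw, by simp, ?_, ?_⟩
    · rw [div_eq_iff ha'] at h1
      rw [h1]; push_cast; ring
    · rw [div_eq_iff ha'] at h2
      rw [h2]; push_cast; ring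
  · obtain ⟨u, w, hu, hw, h1, h2⟩ := exists_sin_coords (x₀ / a) (ρ / a) (by positivity)
    have hc : Complex.cosh ((w : ℂ) - (Real.pi / 2 : ℝ) * Complex.I)
        = -(Complex.I * Complex.sinh w) := by
      rw [Complex.cosh_sub, Complex.cosh_mul_I, Complex.sinh_mul_I, ← Complex.ofReal_cos,
        ← Complex.ofReal_sin, Real.cos_pi_div_two, Real.sin_pi_div_two]
      push_cast; ring
    have hs : Complex.sinh ((w : ℂ) - (Real.pi / 2 : ℝ) * Complex.I)
        = -(Complex.I * Complex.cosh w) := by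
      rw [Complex.sinh_sub, Complex.cosh_mul_I, Complex.sinh_mul_I, ← Complex.ofReal_cos,
        ← Complex.ofReal_sin, Real.cos_pi_div_two, Real.sin_pi_div_two]
      push_cast; ring
    refine ⟨(u, (w : ℂ) - (Real.pi / 2 : ℝ) * Complex.I), hu, ?_, ?_, ?_, ?_⟩
    · simpa using hw
    · have : (a : ℝ) ≠ 0 := ha.ne'
      simp [this]
    · rw [div_eq_iff ha.ne'] at h1
      rw [hc, h1]; push_cast
      linear_combination ((a : ℂ) * Complex.cos u * Complex.sinh w) * Complex.I_sq
    · rw [div_eq_iff ha.ne'] at h2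
      rw [hs, h2]; push_cast
      linear_combination ((a : ℂ) * Complex.sin u * Complex.cosh w) * Complex.I_sq

theorem iterate_derivative_comp_neg (p : ℝ[X]) (j : ℕ) :
    derivative^[j] (p.comp (-X)) = (-1) ^ j * (derivative^[j] p).comp (-X) := by
  induction j with
  | zero => simp
  | succ j ih =>
    have hc : ∀ q : ℝ[X], (-1) ^ j * q = C ((-1) ^ j) * q := by intro q; simp
    rw [Function.iterate_succ_apply', ih, hc, derivative_C_mul, derivative_comp,
      Function.iterate_succ_apply', derivative_neg, derivative_X, ← hc, pow_succ]
    ring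

theorem legendre_comp_neg (n : ℕ) : (legendre n).comp (-X) = (-1) ^ n * legendre n := by
  have h : ((X ^ 2 - 1 : ℝ[X]) ^ n).comp (-X) = (X ^ 2 - 1) ^ n := by
    simp
  have h2 := congrArg (fun p : ℝ[X] => derivative^[n] p) h
  simp only [iterate_derivative_comp_neg] at h2
  rw [legendre, mul_comp, C_comp]
  have h3 : (derivative^[n] ((X ^ 2 - 1 : ℝ[X]) ^ n)).comp (-X)
      = (-1) ^ n * derivative^[n] ((X ^ 2 - 1 : ℝ[X]) ^ n) := by
    conv_rhs => rw [← h2, ← mul_assoc, ← mul_pow]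
    simp
  rw [h3]; ring

theorem aeval_neg_legendre (n m : ℕ) (z : ℂ) :
    aeval (-z) (derivative^[m] (legendre n)) =
      (-1) ^ (n + m) * aeval z (derivative^[m] (legendre n)) := by
  have h2 := congrArg (fun p : ℝ[X] => aeval z (derivative^[m] p)) (legendre_comp_neg n)
  have hc : ((-1 : ℝ[X]) ^ n * legendre n) = C ((-1) ^ n) * legendre n := by simp
  simp only [hc, iterate_derivative_C_mul, iterate_derivative_comp_neg] at h2
  simp [aeval_comp] at h2
  have h3 : ((-1 : ℂ) ^ m) * (-1) ^ m = 1 := by rw [← mul_pow]; simp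
  rw [pow_add]
  linear_combination (-1) ^ m * h2 - aeval (-z) (derivative^[m] (legendre n)) * h3

/-- The value of `U_{n,m}[μ]` may be computed in any spheroidal coordinates of the point. -/
theorem harmonicU_eq {n m : ℕ} {μ : ℂ} (h0 : μ ≠ 0) {x₀ ρ u : ℝ} {v : ℂ}
    (h : IsSpheroidalCoord μ x₀ ρ u v) : harmonicU n m μ x₀ ρ = harmonicUCoord n m μ u v := by
  have hex : ∃ p : ℝ × ℂ, IsSpheroidalCoord μ x₀ ρ p.1 p.2 := ⟨(u, v), h⟩
  rw [harmonicU, if_neg h0, dif_pos hex]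
  generalize hex.choose = q, hex.choose_spec = hq
  obtain ⟨u', v'⟩ := q
  have key : ∀ {u : ℝ} {v : ℂ}, IsSpheroidalCoord μ x₀ ρ u v →
      harmonicUCoord n m μ u v =
        ((n - m).factorial : ℂ) / (2 ^ n * (ascPochhammer ℂ n).eval (1 / 2)) * μ ^ n * (-1) ^ m *
          (ρ / μ) ^ m * (aeval (Complex.cos u) (derivative^[m] (legendre n)) *
            aeval (Complex.cosh v) (derivative^[m] (legendre n))) := by
    intro u v h
    obtain ⟨hu, -, -, -, h2⟩ := h
    have hs : √(1 - Real.cos u ^ 2) = Real.sin u := by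
      rw [← Real.sin_sq, Real.sqrt_sq (Real.sin_nonneg_of_nonneg_of_le_pi hu.1 hu.2)]
    have hr : (ρ : ℂ) / μ = Complex.sin u * Complex.sinh v := by
      rw [h2]; field_simp
    have he : ((eval (Real.cos u) (derivative^[m] (legendre n)) : ℝ) : ℂ)
        = aeval (Complex.cos u) (derivative^[m] (legendre n)) := by
      rw [← Complex.ofReal_cos]
      exact (aeval_algebraMap_apply_eq_algebraMap_eval (A := ℂ) (Real.cos u)
        (derivative^[m] (legendre n))).symm
    rw [harmonicUCoord, assocLegendre, assocLegendreCosh, hs, hr, mul_pow]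
    push_cast
    rw [he]
    ring
  rw [key h, key hq]
  congr 1
  obtain ⟨-, -, -, h1, h2⟩ := h
  obtain ⟨-, -, -, h1', h2'⟩ := hq
  have e1 : Complex.cos u' * Complex.cosh v' = Complex.cos u * Complex.cosh v := by
    apply mul_left_cancel₀ h0
    linear_combination h1 - h1'
  have e2 : Complex.sin u' * Complex.sinh v' = Complex.sin u * Complex.sinh v := by
    apply mul_left_cancel₀ h0
    linear_combination h2 - h2'
  have e3 : (Complex.cos u' + Complex.cosh v') ^ 2 = (Complex.cos u + Complex.cosh v) ^ 2 := by
    have s : Complex.cos u' ^ 2 + Complex.cosh v' ^ 2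
        = 1 + (Complex.cos u' * Complex.cosh v') ^ 2 + (Complex.sin u' * Complex.sinh v') ^ 2 := by
      rw [mul_pow, mul_pow, Complex.sinh_sq, Complex.sin_sq]; ring
    have t : Complex.cos u ^ 2 + Complex.cosh v ^ 2
        = 1 + (Complex.cos u * Complex.cosh v) ^ 2 + (Complex.sin u * Complex.sinh v) ^ 2 := by
      rw [mul_pow, mul_pow, Complex.sinh_sq, Complex.sin_sq]; ring
    rw [e1, e2] at s
    linear_combination s - t + 2 * e1
  have hneg : ∀ a b : ℂ, aeval (-a) (derivative^[m] (legendre n)) *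
      aeval (-b) (derivative^[m] (legendre n)) = aeval a (derivative^[m] (legendre n)) *
      aeval b (derivative^[m] (legendre n)) := by
    intro a b
    rw [aeval_neg_legendre, aeval_neg_legendre]
    have : ((-1 : ℂ) ^ (n + m)) * (-1) ^ (n + m) = 1 := by rw [← mul_pow]; simp
    linear_combination (aeval a (derivative^[m] (legendre n)) *
      aeval b (derivative^[m] (legendre n))) * this
  have hswap : ∀ a b c d : ℂ, a + b = c + d → a * b = c * d →
      aeval a (derivative^[m] (legendre n)) * aeval b (derivative^[m] (legendre n)) =
      aeval c (derivative^[m] (legendre n)) * aeval d (derivative^[m] (legendre n)) := by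
    intro a b c d hs hp
    have : (a - c) * (a - d) = 0 := by linear_combination a * hs - hp
    rcases mul_eq_zero.1 this with h | h
    · have ha : a = c := by linear_combination h
      have hb : b = d := by linear_combination hs - h
      rw [ha, hb]
    · have ha : a = d := by linear_combination h
      have hb : b = c := by linear_combination hs - h
      rw [ha, hb, mul_comm]
  rcases sq_eq_sq_iff_eq_or_eq_neg.1 e3 with h | h
  · exact hswap _ _ _ _ h e1
  · rw [← hneg (Complex.cos u)]
    exact hswap _ _ _ _ (by linear_combination h) (by linear_combination e1)

end SpheroidalHarmonics

end

/-! The theorem reduces to polynomials on the symmetry axis. A function `ρ^m g(x₀, ρ)`, with `g` a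
polynomial even in `ρ`, that is harmonic with angular frequency `m` is determined by `p = g(·, 0)`:
it equals `ρ^m ∑ c_k ρ^(2k) p^(2k)(x₀)`, with `c_k` forced by Laplace's equation.

The product formula `eval_mul_eval_iterate_derivative` gives this form for spheroidal harmonics.
With `a = cos u` fixed, the product of Legendre derivatives and the series are both polynomials in
`cosh v`. They solve the same ultraspherical equation, whose polynomial solutions are determined by
the value at the singular point 1. Comparing top coefficients covers the ball. Thus
(`harmonicU_eq_sum`) `U_{n,m}[μ]` extends a multiple of the `m`-th derivative of `μ^n P_n(x/μ)`, and
(`garabedianV_eq`) `V_{n,m}[μ]` extends a multiple of the `m`-th derivative of the scaled Gegenbauer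
polynomial `μ^n C_n^(3/2)(x/μ)`.

Extension is linear and injective, so the coefficients are the connection coefficients between
Gegenbauer polynomials of two scales (`scaledGegenbauer_connection`), adjusted by normalising
constants. Expanding in monomials and re-expanding these in the other family gives a finite sum,
which is the terminating `₂F₁`. Uniqueness holds because the axis polynomials have distinct degrees
`n - 2k - m`. -/

noncomputable section

namespace SpheroidalHarmonics

open Polynomial

/-! ### Scaled Legendre polynomials -/

/-- The polynomial `μⁿ P_n(x / μ)`, in a form that makes sense for `μ = 0`. -/
def scaledLegendre (n : ℕ) (μ : ℂ) : ℂ[X] :=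
  C (1 / (2 ^ n * (n.factorial : ℂ))) * derivative^[n] ((X ^ 2 - C (μ ^ 2)) ^ n)

theorem aeval_iterate_derivative_legendre (n m : ℕ) (z : ℂ) :
    aeval z (derivative^[m] (legendre n)) = (derivative^[m] (scaledLegendre n 1)).eval z := by
  have h : (legendre n).map (algebraMap ℝ ℂ) = scaledLegendre n 1 := by
    simp [legendre, scaledLegendre, ← iterate_derivative_map]
  rw [← h, iterate_derivative_map, aeval_def, eval₂_eq_eval_map]

theorem natDegree_iterate_derivative_scaledLegendre_le (n j : ℕ) (μ : ℂ) :
    (derivative^[j] (scaledLegendre n μ)).natDegree ≤ n - j := by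
  refine (natDegree_iterate_derivative _ _).trans (Nat.sub_le_sub_right ?_ j)
  refine (natDegree_C_mul_le _ _).trans ((natDegree_iterate_derivative _ _).trans ?_)
  have : ((X ^ 2 - C (μ ^ 2) : ℂ[X]) ^ n).natDegree ≤ n * 2 := by
    refine natDegree_pow_le.trans (Nat.mul_le_mul_left _ ?_)
    exact (natDegree_X_pow_sub_C (R := ℂ)).le
  omega

theorem iterate_derivative_scaledLegendre_eq_zero {n j : ℕ} (h : n < j) (μ : ℂ) :
    derivative^[j] (scaledLegendre n μ) = 0 :=
  iterate_derivative_eq_zero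
    ((natDegree_iterate_derivative_scaledLegendre_le n 0 μ).trans_lt (by simpa using h))

theorem iterate_derivative_comp_C_mul_X (p : ℂ[X]) (μ : ℂ) (j : ℕ) :
    derivative^[j] (p.comp (C μ * X)) = C (μ ^ j) * (derivative^[j] p).comp (C μ * X) := by
  induction j with
  | zero => simp
  | succ j ih =>
    rw [Function.iterate_succ_apply', ih, derivative_C_mul, derivative_comp,
      Function.iterate_succ_apply', derivative_C_mul, derivative_X, pow_succ, C_mul]
    ring

/-- Substituting `μX` into `(X² - μ²)^n` produces `μ^(2n)`, of which the `n` derivatives in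
Rodrigues' formula absorb `μ^n`. -/
theorem scaledLegendre_comp (n : ℕ) {μ : ℂ} (h0 : μ ≠ 0) :
    (scaledLegendre n μ).comp (C μ * X) = C (μ ^ n) * scaledLegendre n 1 := by
  have h : ((X ^ 2 - C (μ ^ 2) : ℂ[X]) ^ n).comp (C μ * X)
      = C (μ ^ (2 * n)) * (X ^ 2 - C (1 ^ 2)) ^ n := by
    simp only [pow_comp, sub_comp, X_comp, C_comp, pow_mul, C_pow]
    rw [← mul_pow]
    congr 1
    simp only [map_one]
    ring
  have h2 := congrArg (fun p : ℂ[X] => derivative^[n] p) h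
  simp only [iterate_derivative_comp_C_mul_X, iterate_derivative_C_mul] at h2
  have h3 : (C (μ ^ n) : ℂ[X]) ≠ 0 := C_ne_zero.2 (pow_ne_zero n h0)
  apply mul_left_cancel₀ h3
  rw [scaledLegendre, scaledLegendre, mul_comp, C_comp]
  rw [two_mul, pow_add, C_mul] at h2
  linear_combination C (1 / (2 ^ n * (n.factorial : ℂ))) * h2

theorem eval_iterate_derivative_scaledLegendre (n j : ℕ) {μ : ℂ} (h0 : μ ≠ 0) (y : ℂ) :
    μ ^ j * (derivative^[j] (scaledLegendre n μ)).eval (μ * y)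
      = μ ^ n * (derivative^[j] (scaledLegendre n 1)).eval y := by
  have h := congrArg (fun p : ℂ[X] => (derivative^[j] p).eval y) (scaledLegendre_comp n h0)
  simp only [iterate_derivative_comp_C_mul_X, iterate_derivative_C_mul] at h
  simpa using h

/-! ### Legendre's equation and its derivatives -/

/-- Differentiating an ultraspherical differential equation. -/
theorem iterate_derivative_ode {y : ℂ[X]} {α β : ℂ}
    (h : (1 - X ^ 2) * derivative (derivative y) - C α * X * derivative y + C β * y = 0) (j : ℕ) :
    (1 - X ^ 2) * derivative^[j + 2] y - C (α + 2 * j) * X * derivative^[j + 1] y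
      + C (β - j * (α + j - 1)) * derivative^[j] y = 0 := by
  induction j with
  | zero => simpa using h
  | succ j ih =>
    have := congrArg derivative ih
    simp only [derivative_add, derivative_sub, derivative_mul, derivative_C, derivative_X,
      derivative_one, derivative_X_pow, derivative_zero, ← Function.iterate_succ_apply'] at this
    simp only [Function.iterate_succ_apply'] at this ⊢
    simp only [map_add, map_sub, map_mul, map_natCast, map_ofNat, map_one, Nat.cast_add,
      Nat.cast_one, Nat.cast_ofNat] at this ⊢
    linear_combination this

/-- Legendre's equation, differentiated `j` times. -/
theorem legendre_ode (n j : ℕ) :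
    (1 - X ^ 2) * derivative^[j + 2] (scaledLegendre n 1)
      - C (2 * (j + 1) : ℂ) * X * derivative^[j + 1] (scaledLegendre n 1)
      + C (n * (n + 1) - j * (j + 1) : ℂ) * derivative^[j] (scaledLegendre n 1) = 0 := by
  -- The power `(X² - 1)^n` satisfies a first-order equation. One differentiation makes it
  -- ultraspherical with `α = 2 - 2n`, `β = 2n`, and `n + j` further ones give the claim through
  -- Rodrigues' formula.
  have h0 : (1 - X ^ 2) * derivative ((X ^ 2 - C ((1 : ℂ) ^ 2)) ^ n)
      = C (-2 * n : ℂ) * X * (X ^ 2 - C ((1 : ℂ) ^ 2)) ^ n := by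
    cases n with
    | zero => simp
    | succ n =>
      rw [derivative_pow_succ]
      simp only [one_pow, map_one, derivative_sub, derivative_X_pow, derivative_one, map_mul,
        map_neg, map_natCast, map_ofNat, map_add, Nat.cast_add, Nat.cast_one, Nat.cast_ofNat]
      ring
  have h1 : (1 - X ^ 2) * derivative (derivative ((X ^ 2 - C ((1 : ℂ) ^ 2)) ^ n))
      - C (2 - 2 * n : ℂ) * X * derivative ((X ^ 2 - C ((1 : ℂ) ^ 2)) ^ n)
      + C (2 * n : ℂ) * (X ^ 2 - C ((1 : ℂ) ^ 2)) ^ n = 0 := by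
    generalize (X ^ 2 - C ((1 : ℂ) ^ 2)) ^ n = y at h0
    have := congrArg derivative h0
    simp only [derivative_sub, derivative_mul, derivative_C, derivative_X, derivative_one,
      derivative_X_pow] at this
    simp only [map_sub, map_mul, map_neg, map_natCast, map_ofNat, Nat.cast_ofNat] at this ⊢
    linear_combination this
  have h2 := iterate_derivative_ode h1 (n + j)
  have e : ∀ i, derivative^[i] (scaledLegendre n 1) = C (1 / (2 ^ n * (n.factorial : ℂ))) *
      derivative^[n + i] ((X ^ 2 - C ((1 : ℂ) ^ 2)) ^ n) := by
    intro i
    rw [scaledLegendre, iterate_derivative_C_mul, ← Function.iterate_add_apply, add_comm]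
  rw [e, e, e]
  simp only [add_assoc, map_sub, map_add, map_mul, map_natCast, map_ofNat, Nat.cast_add,
    map_one] at h2 ⊢
  linear_combination C (1 / (2 ^ n * (n.factorial : ℂ))) * h2

/-- A polynomial solution of an ultraspherical equation is determined by its value at `1`. -/
theorem eq_zero_of_ode {y : ℂ[X]} {m : ℕ} {β : ℂ}
    (h : (1 - X ^ 2) * derivative (derivative y) - C (2 * (m + 1) : ℂ) * X * derivative y
      + C β * y = 0) (h1 : y.eval 1 = 0) : y = 0 := by
  have key : ∀ j, (derivative^[j] y).eval 1 = 0 := by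
    intro j
    induction j with
    | zero => simpa using h1
    | succ j ih =>
      -- At 1 the leading coefficient vanishes, so the equation becomes a recursion expressing the
      -- next derivative at 1 through the current one, with multiplier `2(m+1) + 2j ≠ 0`.
      have := congrArg (eval 1) (iterate_derivative_ode h j)
      simp only [eval_add, eval_sub, eval_mul, eval_one, eval_pow, eval_X, eval_C, ih,
        eval_zero] at this
      have hne : (2 * (m + 1) + 2 * j : ℂ) ≠ 0 := by
        have : ((2 * (m + 1) + 2 * j : ℕ) : ℂ) ≠ 0 := by
          rw [Nat.cast_ne_zero]; omega
        exact_mod_cast this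
      have h2 : (2 * (m + 1) + 2 * j : ℂ) * (derivative^[j + 1] y).eval 1 = 0 := by
        linear_combination -this
      exact (mul_eq_zero.1 h2).resolve_left hne
  apply eq_zero_of_hasseDeriv_eq_zero y 1
  intro k
  have := key k
  rw [← factorial_smul_hasseDeriv] at this
  simpa [Nat.factorial_ne_zero] using this

/-! ### The product formula in spheroidal coordinates -/

/-- The coefficients of the expansion of an axially harmonic function in powers of `ρ²`. -/
def axialCoeff (m k : ℕ) : ℂ :=
  (-1) ^ k * (m.factorial : ℂ) / (4 ^ k * (k.factorial : ℂ) * ((m + k).factorial : ℂ))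

@[simp] theorem axialCoeff_zero (m : ℕ) : axialCoeff m 0 = 1 := by
  simp [axialCoeff, Nat.factorial_ne_zero]

/-- This recursion is Laplace's equation for angular frequency `m`: the radial part multiplies
`ρ^(m+2k+2)` by `(m+2k+2)² - m² = 4(k+1)(k+1+m)` and lowers its degree by two. -/
theorem axialCoeff_succ (m k : ℕ) :
    4 * (k + 1) * (k + 1 + m) * axialCoeff m (k + 1) = -axialCoeff m k := by
  have h1 : (k.factorial : ℂ) ≠ 0 := by exact_mod_cast k.factorial_ne_zero
  have h2 : ((m + k).factorial : ℂ) ≠ 0 := by exact_mod_cast (m + k).factorial_ne_zero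
  have h3 : (k + 1 : ℂ) ≠ 0 := by exact_mod_cast k.succ_ne_zero
  have h4 : (m + k + 1 : ℂ) ≠ 0 := by exact_mod_cast (m + k).succ_ne_zero
  rw [axialCoeff, axialCoeff, ← add_assoc, Nat.factorial_succ, Nat.factorial_succ]
  push_cast
  field_simp
  ring

/-- The extension off the axis of `P_n^{(m)}`, in spheroidal coordinates, for fixed `a = cos u`. -/
def axialSeries (n m : ℕ) (a : ℂ) (K : ℕ) : ℂ[X] :=
  ∑ k ∈ Finset.range K, C (axialCoeff m k) * (C (1 - a ^ 2) * (X ^ 2 - 1)) ^ k *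
    (derivative^[m + 2 * k] (scaledLegendre n 1)).comp (C a * X)

/-- A partial sum satisfies the ultraspherical equation up to one residual term, which the next
summand cancels by the recursion for `axialCoeff`. The residual arises because Legendre's equation
at `aX` has leading coefficient `1 - a²X²`, whereas the chain rule gives `a²(1 - X²)`; these differ
by `1 - a²`. -/
theorem axialSeries_ode (n m : ℕ) (a : ℂ) (K : ℕ) :
    (1 - X ^ 2) * derivative (derivative (axialSeries n m a (K + 1)))
      - C (2 * (m + 1) : ℂ) * X * derivative (axialSeries n m a (K + 1))
      + C (n * (n + 1) - m * (m + 1) : ℂ) * axialSeries n m a (K + 1)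
      = -C (axialCoeff m K * (1 - a ^ 2)) * (C (1 - a ^ 2) * (X ^ 2 - 1)) ^ K *
        (derivative^[m + 2 * (K + 1)] (scaledLegendre n 1)).comp (C a * X) := by
  set f : ℕ → ℂ[X] := fun j => (derivative^[j] (scaledLegendre n 1)).comp (C a * X) with hf
  have ode : ∀ j, (1 - (C a * X) ^ 2) * f (j + 2) - C (2 * (j + 1) : ℂ) * (C a * X) * f (j + 1)
      + C (n * (n + 1) - j * (j + 1) : ℂ) * f j = 0 := by
    intro j
    simpa [hf] using congrArg (fun p : ℂ[X] => p.comp (C a * X)) (legendre_ode n j)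
  have der : ∀ j, derivative (f j) = C a * f (j + 1) := by
    intro j
    simp only [hf]
    rw [derivative_comp, Function.iterate_succ_apply', derivative_C_mul, derivative_X, mul_one]
  have hS : ∀ K, axialSeries n m a K = ∑ k ∈ Finset.range K, C (axialCoeff m k) *
    (C (1 - a ^ 2) * (X ^ 2 - 1)) ^ k * f (m + 2 * k) := fun K => rfl
  change _ = -C (axialCoeff m K * (1 - a ^ 2)) * (C (1 - a ^ 2) * (X ^ 2 - 1)) ^ K *
    f (m + 2 * (K + 1))
  clear_value f
  clear hf
  induction K with
  | zero =>
    have h := ode m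
    simp only [hS, Finset.sum_range_one, axialCoeff_zero, pow_zero, mul_zero, add_zero, map_one,
      one_mul, mul_one, zero_add, der, derivative_mul, derivative_C]
    simp only [map_sub, map_add, map_mul, map_natCast, map_ofNat, map_one, map_pow, zero_mul,
      zero_add] at h ⊢
    linear_combination h
  | succ K ih =>
    have hw : derivative ((C (1 - a ^ 2) * (X ^ 2 - 1)) ^ (K + 1))
        = C (2 * (K + 1) : ℂ) * X * C (1 - a ^ 2) * (C (1 - a ^ 2) * (X ^ 2 - 1)) ^ K := by
      rw [derivative_pow_succ, derivative_C_mul, derivative_sub, derivative_X_pow, derivative_one]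
      simp only [map_add, map_mul, map_natCast, map_ofNat, map_one, Nat.cast_ofNat, map_sub,
        map_pow]
      ring
    have hw1 : (1 - X ^ 2) * derivative ((C (1 - a ^ 2) * (X ^ 2 - 1)) ^ (K + 1))
        = -C (2 * (K + 1) : ℂ) * X * (C (1 - a ^ 2) * (X ^ 2 - 1)) ^ (K + 1) := by
      rw [hw]; ring
    have hw2 : (1 - X ^ 2) * derivative (derivative ((C (1 - a ^ 2) * (X ^ 2 - 1)) ^ (K + 1)))
        = 2 * X * derivative ((C (1 - a ^ 2) * (X ^ 2 - 1)) ^ (K + 1))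
          - C (2 * (K + 1) : ℂ) * (C (1 - a ^ 2) * (X ^ 2 - 1)) ^ (K + 1)
          - C (2 * (K + 1) : ℂ) * X * derivative ((C (1 - a ^ 2) * (X ^ 2 - 1)) ^ (K + 1)) := by
      have := congrArg derivative hw1
      simp only [derivative_mul, derivative_sub, derivative_one, derivative_X_pow, derivative_X,
        derivative_C, derivative_neg] at this
      simp only [Nat.cast_ofNat, map_ofNat] at this
      linear_combination this
    have h := ode (m + 2 * (K + 1))
    have hc := congrArg (C : ℂ → ℂ[X]) (axialCoeff_succ m K)
    rw [hS, Finset.sum_range_succ, ← hS]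
    simp only [derivative_add, derivative_mul, derivative_C, der, zero_mul, zero_add]
    rw [show m + 2 * (K + 1 + 1) = m + 2 * (K + 1) + 2 by ring]
    generalize axialSeries n m a (K + 1) = S at *
    rw [hw] at hw2
    rw [hw]
    generalize f (m + 2 * (K + 1)) = f0 at *
    generalize f (m + 2 * (K + 1) + 1) = f1 at *
    generalize f (m + 2 * (K + 1) + 1 + 1) = f2 at *
    generalize derivative (C (2 * (K + 1) : ℂ) * X * C (1 - a ^ 2) *
      (C (1 - a ^ 2) * (X ^ 2 - 1)) ^ K) = e2 at *
    rw [pow_succ _ K] at hw2 ⊢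
    generalize (C (1 - a ^ 2) * (X ^ 2 - 1)) ^ K = w at *
    generalize axialCoeff m (K + 1) = c1 at *
    generalize axialCoeff m K = c0 at *
    simp only [map_sub, map_add, map_mul, map_natCast, map_ofNat, map_one, map_pow, map_neg,
      Nat.cast_add, Nat.cast_mul, Nat.cast_one, Nat.cast_ofNat] at ih h hc hw2 ⊢
    linear_combination ih + C c1 * f0 * hw2 + C c1 * w * (1 - C a ^ 2) * (X ^ 2 - 1) * h
      - (1 - C a ^ 2) * w * f0 * hc

theorem eval_one_axialSeries (n m : ℕ) (a : ℂ) (K : ℕ) :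
    (axialSeries n m a (K + 1)).eval 1 = (derivative^[m] (scaledLegendre n 1)).eval a := by
  rw [axialSeries, Finset.sum_range_succ', eval_add, eval_finsetSum, Finset.sum_eq_zero]
  · simp
  · intro k _
    simp

/-- For `K = n` the residual contains a derivative of order above `n`, hence vanishes. Both sides
then solve the same equation and agree at 1, where only the term `k = 0` of the series survives. -/
theorem C_mul_iterate_derivative_scaledLegendre (n m : ℕ) (a : ℂ) :
    C ((derivative^[m] (scaledLegendre n 1)).eval a) * derivative^[m] (scaledLegendre n 1)
      = C ((derivative^[m] (scaledLegendre n 1)).eval 1) * axialSeries n m a (n + 1) := by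
  have h1 := axialSeries_ode n m a n
  rw [iterate_derivative_scaledLegendre_eq_zero (by omega), zero_comp, mul_zero] at h1
  have h2 := legendre_ode n m
  have h3 := eval_one_axialSeries n m a n
  simp only [Function.iterate_succ_apply'] at h2
  generalize derivative^[m] (scaledLegendre n 1) = q at *
  rw [← sub_eq_zero]
  apply eq_zero_of_ode (m := m) (β := n * (n + 1) - m * (m + 1))
  · simp only [derivative_sub, derivative_C_mul]
    linear_combination C (q.eval a) * h2 - C (q.eval 1) * h1
  · simp only [eval_sub, eval_mul, eval_C, h3]
    ring

/-- The product formula: the product of derivatives of Legendre polynomials in spheroidal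
coordinates is the axially harmonic extension of its values on the axis. -/
theorem eval_mul_eval_iterate_derivative (n m : ℕ) (a b : ℂ) :
    (derivative^[m] (scaledLegendre n 1)).eval a * (derivative^[m] (scaledLegendre n 1)).eval b
      = (derivative^[m] (scaledLegendre n 1)).eval 1 * ∑ k ∈ Finset.range (n + 1),
        axialCoeff m k * ((1 - a ^ 2) * (b ^ 2 - 1)) ^ k *
          (derivative^[m + 2 * k] (scaledLegendre n 1)).eval (a * b) := by
  have h := congrArg (eval b) (C_mul_iterate_derivative_scaledLegendre n m a)
  rw [eval_mul, eval_C, eval_mul, eval_C, axialSeries, eval_finsetSum] at h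
  simpa using h

/-! ### Leading coefficients and values at 1 -/

/-- The leading coefficient of the `j`-th derivative of `P_n`. -/
def leadCoeff (n j : ℕ) : ℂ :=
  (n.descFactorial j : ℂ) * ((2 * n).descFactorial n : ℂ) / (2 ^ n * (n.factorial : ℂ))

theorem coeff_iterate_derivative_scaledLegendre {n j : ℕ} (h : j ≤ n) (μ : ℂ) :
    (derivative^[j] (scaledLegendre n μ)).coeff (n - j) = leadCoeff n j := by
  have hm : ((X ^ 2 - C (μ ^ 2) : ℂ[X]) ^ n).coeff (2 * n) = 1 := by
    have h1 : ((X ^ 2 - C (μ ^ 2) : ℂ[X]) ^ n).Monic := (monic_X_pow_sub_C _ two_ne_zero).pow n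
    have h2 : ((X ^ 2 - C (μ ^ 2) : ℂ[X]) ^ n).natDegree = 2 * n := by
      rw [natDegree_pow, natDegree_X_pow_sub_C, mul_comm]
    rw [← h2]; exact h1
  rw [coeff_iterate_derivative, Nat.sub_add_cancel h, scaledLegendre, coeff_C_mul,
    coeff_iterate_derivative, ← two_mul, hm, leadCoeff]
  simp only [nsmul_eq_mul]
  ring

theorem eval_iterate_derivative_scaledLegendre_zero {n j : ℕ} (h : j ≤ n) (x : ℂ) :
    (derivative^[j] (scaledLegendre n 0)).eval x = leadCoeff n j * x ^ (n - j) := by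
  have h2 : derivative^[j] (scaledLegendre n 0) = C (leadCoeff n j) * X ^ (n - j) := by
    rw [scaledLegendre, iterate_derivative_C_mul, ← Function.iterate_add_apply]
    simp only [ne_eq, OfNat.ofNat_ne_zero, not_false_eq_true, zero_pow, map_zero, sub_zero,
      ← pow_mul]
    rw [Function.iterate_add_apply, iterate_derivative_X_pow_eq_natCast_mul,
      ← C_eq_natCast, iterate_derivative_C_mul, iterate_derivative_X_pow_eq_natCast_mul,
      ← C_eq_natCast, ← mul_assoc, ← mul_assoc, ← C_mul, ← C_mul, leadCoeff]
    congr 2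
    · rw [show 2 * n - n = n by omega]; ring
    · omega
  rw [h2]
  simp

theorem eval_one_iterate_derivative (n m : ℕ) (h : m ≤ n) :
    (derivative^[m] (scaledLegendre n 1)).eval 1
      = ((n + m).factorial : ℂ) / (2 ^ m * (m.factorial : ℂ) * ((n - m).factorial : ℂ)) := by
  -- Descending induction on the order of differentiation at fixed degree `N`. It starts from the
  -- constant `N`-th derivative and descends by Legendre's equation at 1, `2(m+1) q_(m+1)(1) =
  -- (N-m)(N+m+1) q_m(1)`.
  obtain ⟨d, rfl⟩ := Nat.exists_eq_add_of_le h
  clear h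
  generalize hN : m + d = N
  induction d generalizing m with
  | zero =>
    obtain rfl : m = N := by omega
    have h1 := coeff_iterate_derivative_scaledLegendre (le_refl m) 1
    have h2 := natDegree_iterate_derivative_scaledLegendre_le m m 1
    rw [Nat.sub_self] at h1 h2
    rw [eq_C_of_natDegree_le_zero h2, h1, eval_C, leadCoeff, Nat.descFactorial_self, ← two_mul,
      Nat.sub_self]
    have h3 := Nat.factorial_mul_descFactorial (show m ≤ 2 * m by omega)
    rw [← h3, show 2 * m - m = m by omega]
    push_cast
    simp
  | succ d ih =>
    have h := ih (m + 1) (by omega)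
    have h2 := congrArg (eval 1) (legendre_ode N m)
    simp only [eval_add, eval_sub, eval_mul, eval_one, eval_pow, eval_X, eval_C, eval_zero, h]
      at h2
    rw [show N - (m + 1) = d by omega, ← add_assoc, Nat.factorial_succ, Nat.factorial_succ] at h2
    rw [show N - m = d + 1 by omega, Nat.factorial_succ]
    have hNc : (N : ℂ) = m + d + 1 := by rw [← hN]; push_cast; ring
    have f1 : (m.factorial : ℂ) ≠ 0 := by exact_mod_cast m.factorial_ne_zero
    have f2 : (d.factorial : ℂ) ≠ 0 := by exact_mod_cast d.factorial_ne_zero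
    have f3 : (m + 1 : ℂ) ≠ 0 := by exact_mod_cast m.succ_ne_zero
    have f4 : (d + 1 : ℂ) ≠ 0 := by exact_mod_cast d.succ_ne_zero
    have f5 : (m + d + 1 + m + 1 : ℂ) ≠ 0 := by exact_mod_cast (m + d + 1 + m).succ_ne_zero
    push_cast at h2 ⊢
    generalize ((N + m).factorial : ℂ) = F at *
    rw [hNc] at h2
    rw [eq_div_iff (mul_ne_zero (mul_ne_zero (by norm_num) f1) (mul_ne_zero f4 f2))]
    have h3 : (m + d + 1 + m + 1 : ℂ) * ((d + 1) *
      (derivative^[m] (scaledLegendre N 1)).eval 1 * (2 ^ m * m.factorial * d.factorial) - F)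
        = 0 := by
      field_simp at h2
      linear_combination (1 / 2) * h2
    have h4 := (mul_eq_zero.1 h3).resolve_left f5
    linear_combination h4

/-- The product formula at infinity: the harmonic extension of a power. -/
theorem leadCoeff_mul_eval_iterate_derivative {n m : ℕ} (h : m ≤ n) (a : ℂ) :
    leadCoeff n m * (derivative^[m] (scaledLegendre n 1)).eval a
      = (derivative^[m] (scaledLegendre n 1)).eval 1 * ∑ k ∈ Finset.range (n + 1),
        if m + 2 * k ≤ n then axialCoeff m k * (1 - a ^ 2) ^ k *
          (leadCoeff n (m + 2 * k) * a ^ (n - (m + 2 * k))) else 0 := by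
  -- In each term the two factors have degrees at most `2k` and `n - m - 2k`, so the coefficient of
  -- `X^(n-m)` is the product of their top coefficients.
  have h1 := congrArg (fun p => coeff p (n - m)) (C_mul_iterate_derivative_scaledLegendre n m a)
  simp only [coeff_C_mul, axialSeries, finsetSum_coeff] at h1
  rw [coeff_iterate_derivative_scaledLegendre h, mul_comm] at h1
  rw [h1]
  congr 1
  refine Finset.sum_congr rfl fun k _ => ?_
  split_ifs with hk
  · rw [mul_assoc, coeff_C_mul, mul_assoc]
    congr 1
    rw [mul_pow, ← C_pow, mul_assoc, coeff_C_mul]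
    congr 1
    have e : n - m = k * 2 + (n - (m + 2 * k)) := by omega
    have d1 : ((X ^ 2 - 1 : ℂ[X]) ^ k).natDegree ≤ k * 2 := by
      refine natDegree_pow_le.trans (Nat.mul_le_mul_left _ ?_)
      exact (natDegree_X_pow_sub_C (R := ℂ) (r := 1)).le
    have d2 : ((derivative^[m + 2 * k] (scaledLegendre n 1)).comp (C a * X)).natDegree
        ≤ n - (m + 2 * k) := by
      refine natDegree_comp_le.trans ?_
      have hX : (C a * X).natDegree ≤ 1 := by simpa using natDegree_C_mul_X_pow_le a 1
      exact (Nat.mul_le_mul (natDegree_iterate_derivative_scaledLegendre_le _ _ _) hX).trans_eq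
        (mul_one _)
    have c1 : ((X ^ 2 - 1 : ℂ[X]) ^ k).coeff (k * 2) = 1 := by
      have h1 : ((X ^ 2 - C 1 : ℂ[X]) ^ k).Monic := (monic_X_pow_sub_C _ two_ne_zero).pow k
      have h2 : ((X ^ 2 - C 1 : ℂ[X]) ^ k).natDegree = k * 2 := by
        rw [natDegree_pow, natDegree_X_pow_sub_C]
      rw [← h2]; exact h1
    rw [e, coeff_mul_add_eq_of_natDegree_le d1 d2, c1, one_mul, comp_C_mul_X_coeff,
      coeff_iterate_derivative_scaledLegendre hk]
  · rw [iterate_derivative_scaledLegendre_eq_zero (by omega)]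
    simp

/-! ### Normalisation and the harmonics as extensions from the axis -/

/-- The Pochhammer symbol `(1/2)_n`. -/
def halfPochhammer (n : ℕ) : ℂ := (ascPochhammer ℂ n).eval (1 / 2)

theorem halfPochhammer_succ (n : ℕ) :
    halfPochhammer (n + 1) = halfPochhammer n * (n + 1 / 2) := by
  rw [halfPochhammer, ascPochhammer_succ_eval, halfPochhammer]
  ring

theorem natCast_add_half_ne_zero (n : ℕ) : (n + 1 / 2 : ℂ) ≠ 0 := by
  intro h
  have h2 : ((2 * n + 1 : ℕ) : ℂ) = 0 := by push_cast; linear_combination 2 * h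
  exact absurd h2 (Nat.cast_ne_zero.2 (by omega))

theorem halfPochhammer_ne_zero (n : ℕ) : halfPochhammer n ≠ 0 := by
  induction n with
  | zero => simp [halfPochhammer]
  | succ n ih =>
    rw [halfPochhammer_succ]
    exact mul_ne_zero ih (natCast_add_half_ne_zero n)

theorem factorial_two_mul (n : ℕ) :
    ((2 * n).factorial : ℂ) = 4 ^ n * n.factorial * halfPochhammer n := by
  induction n with
  | zero => simp [halfPochhammer]
  | succ n ih =>
    rw [show 2 * (n + 1) = 2 * n + 1 + 1 by ring, Nat.factorial_succ, Nat.factorial_succ,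
      Nat.factorial_succ, halfPochhammer_succ]
    push_cast
    rw [ih]
    ring

/-- The value of `U_{n,m}[μ]` near the axis, compared with the `m`-th derivative of the scaled
Legendre polynomial. -/
def axisConstant (n m : ℕ) : ℂ :=
  (-1) ^ m * ((n - m).factorial : ℂ) / (2 ^ n * halfPochhammer n) *
    (derivative^[m] (scaledLegendre n 1)).eval 1

/-- The normalising factor of `U_{n,m}[μ]` is the reciprocal of the leading coefficient of
`P_n^(m)`. Hence the ball harmonic, defined without such a factor, has the same `axisConstant`. -/
theorem leadCoeff_normalization {n m : ℕ} (h : m ≤ n) :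
    ((n - m).factorial : ℂ) / (2 ^ n * halfPochhammer n) * leadCoeff n m = 1 := by
  have h1 : ((n - m).factorial : ℂ) * (n.descFactorial m : ℂ) = n.factorial := by
    exact_mod_cast Nat.factorial_mul_descFactorial h
  have h2 : (n.factorial : ℂ) * ((2 * n).descFactorial n : ℂ)
      = 4 ^ n * n.factorial * halfPochhammer n := by
    rw [← factorial_two_mul]
    have := Nat.factorial_mul_descFactorial (show n ≤ 2 * n by omega)
    rw [show 2 * n - n = n by omega] at this
    exact_mod_cast this
  have f1 : (n.factorial : ℂ) ≠ 0 := by exact_mod_cast n.factorial_ne_zero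
  have f2 := halfPochhammer_ne_zero n
  rw [leadCoeff]
  have h4 : (4 : ℂ) ^ n = 2 ^ n * 2 ^ n := by rw [← mul_pow]; norm_num
  rw [h4] at h2
  field_simp
  rw [h1, h2]
  ring

/-- The solid spheroidal harmonics as axially harmonic polynomials. -/
theorem harmonicU_eq_sum {n m : ℕ} (hn : n ≠ 0) (h : m ≤ n) {μ : ℂ} (hμ : IsSpheroidParameter μ)
    (x ρ : ℝ) (hρ : 0 ≤ ρ) :
    harmonicU n m μ x ρ = axisConstant n m * ρ ^ m * ∑ k ∈ Finset.range (n + 1),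
      axialCoeff m k * ρ ^ (2 * k) * (derivative^[m + 2 * k] (scaledLegendre n μ)).eval (x : ℂ) := by
  by_cases h0 : μ = 0
  · subst h0
    rw [harmonicU, if_pos rfl]
    set r := √(x ^ 2 + ρ ^ 2) with hr
    have hr2 : r ^ 2 = x ^ 2 + ρ ^ 2 := Real.sq_sqrt (by positivity)
    have hr0 : 0 ≤ r := Real.sqrt_nonneg _
    clear_value r
    rcases hr0.eq_or_lt with hz | hpos
    -- At the origin `x / r` is the default value of `0 / 0`, but the factor `r^n` is zero. On the
    -- other side every surviving term is homogeneous of degree `n > 0`.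
    · subst hz
      have hx : x = 0 := by nlinarith [sq_nonneg x, sq_nonneg ρ]
      have hρ0 : ρ = 0 := by nlinarith [sq_nonneg x, sq_nonneg ρ]
      subst hx hρ0
      rw [zero_pow hn, zero_mul, Finset.mul_sum, Finset.sum_eq_zero]
      · simp
      · intro k _
        by_cases hk : m + 2 * k ≤ n
        · rw [eval_iterate_derivative_scaledLegendre_zero hk]
          have : (0 : ℂ) ^ m * 0 ^ (2 * k) * 0 ^ (n - (m + 2 * k)) = 0 := by
            rw [← pow_add, ← pow_add, zero_pow (by omega)]
          simp only [Complex.ofReal_zero]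
          linear_combination axisConstant n m * axialCoeff m k * leadCoeff n (m + 2 * k) * this
        · rw [iterate_derivative_scaledLegendre_eq_zero (by omega)]
          simp
    · have hs : √(1 - (x / r) ^ 2) = ρ / r := by
        rw [show 1 - (x / r) ^ 2 = (ρ / r) ^ 2 by field_simp; linarith]
        exact Real.sqrt_sq (by positivity)
      have he : ((eval (x / r) (derivative^[m] (legendre n)) : ℝ) : ℂ)
          = (derivative^[m] (scaledLegendre n 1)).eval ((x : ℂ) / r) := by
        rw [← aeval_iterate_derivative_legendre, ← Complex.ofReal_div]
        exact (aeval_algebraMap_apply_eq_algebraMap_eval (A := ℂ) (x / r)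
          (derivative^[m] (legendre n))).symm
      rw [assocLegendre, hs]
      push_cast
      rw [he]
      have hrc : (r : ℂ) ≠ 0 := by exact_mod_cast hpos.ne'
      have key := leadCoeff_mul_eval_iterate_derivative h ((x : ℂ) / r)
      have norm := leadCoeff_normalization h
      have hsum : (∑ k ∈ Finset.range (n + 1), axialCoeff m k * (ρ : ℂ) ^ (2 * k) *
          (derivative^[m + 2 * k] (scaledLegendre n 0)).eval (x : ℂ)) =
          r ^ (n - m) * ∑ k ∈ Finset.range (n + 1),
            if m + 2 * k ≤ n then axialCoeff m k * (1 - ((x : ℂ) / r) ^ 2) ^ k *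
              (leadCoeff n (m + 2 * k) * ((x : ℂ) / r) ^ (n - (m + 2 * k))) else 0 := by
        rw [Finset.mul_sum]
        refine Finset.sum_congr rfl fun k _ => ?_
        split_ifs with hk
        · rw [eval_iterate_derivative_scaledLegendre_zero hk]
          have h1 : (1 - ((x : ℂ) / r) ^ 2) = (ρ : ℂ) ^ 2 / r ^ 2 := by
            have : (r : ℂ) ^ 2 = x ^ 2 + ρ ^ 2 := by exact_mod_cast hr2
            field_simp
            linear_combination this
          rw [h1, div_pow, div_pow, ← pow_mul, ← pow_mul,
            show n - m = 2 * k + (n - (m + 2 * k)) by omega, pow_add]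
          field_simp
        · rw [iterate_derivative_scaledLegendre_eq_zero (by omega)]
          simp
      rw [hsum, axisConstant]
      generalize (∑ k ∈ Finset.range (n + 1), if m + 2 * k ≤ n then
        axialCoeff m k * (1 - ((x : ℂ) / r) ^ 2) ^ k *
          (leadCoeff n (m + 2 * k) * ((x : ℂ) / r) ^ (n - (m + 2 * k))) else 0) = S at *
      have hrn : (r : ℂ) ^ n = r ^ m * r ^ (n - m) := by
        rw [← pow_add, Nat.add_sub_cancel' h]
      have hq : (r : ℂ) ^ n * (ρ / r) ^ m = ρ ^ m * r ^ (n - m) := by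
        rw [hrn, div_pow]; field_simp
      generalize (derivative^[m] (scaledLegendre n 1)).eval ((x : ℂ) / r) = A at *
      generalize (derivative^[m] (scaledLegendre n 1)).eval 1 = B at *
      linear_combination (-1) ^ m * A * hq + (-1) ^ m * (ρ : ℂ) ^ m * (r : ℂ) ^ (n - m) *
        (((n - m).factorial : ℂ) / (2 ^ n * halfPochhammer n) * key - A * norm)
  · obtain ⟨⟨u, v⟩, huv⟩ := exists_isSpheroidalCoord hμ h0 x ρ hρ
    rw [harmonicU_eq h0 huv]
    obtain ⟨hu, -, -, h1, h2⟩ := huv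
    simp only at hu h1 h2
    have hs : √(1 - Real.cos u ^ 2) = Real.sin u := by
      rw [← Real.sin_sq, Real.sqrt_sq (Real.sin_nonneg_of_nonneg_of_le_pi hu.1 hu.2)]
    have hr : (ρ : ℂ) = μ * (Complex.sin u * Complex.sinh v) := by
      rw [h2]; ring
    have he : ((eval (Real.cos u) (derivative^[m] (legendre n)) : ℝ) : ℂ)
        = (derivative^[m] (scaledLegendre n 1)).eval (Complex.cos u) := by
      rw [← aeval_iterate_derivative_legendre, ← Complex.ofReal_cos]
      exact (aeval_algebraMap_apply_eq_algebraMap_eval (A := ℂ) (Real.cos u)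
        (derivative^[m] (legendre n))).symm
    -- With `a = cos u` and `b = cosh v`, the coordinates give `ab = x/μ` and `(1 - a²)(b² - 1) =
    -- (ρ/μ)²`; the powers of `μ` are absorbed by the scaling law.
    have key := eval_mul_eval_iterate_derivative n m (Complex.cos u) (Complex.cosh v)
    rw [harmonicUCoord, assocLegendre, assocLegendreCosh, hs]
    push_cast
    rw [he, aeval_iterate_derivative_legendre]
    have hsum : (ρ : ℂ) ^ m * (∑ k ∈ Finset.range (n + 1), axialCoeff m k * (ρ : ℂ) ^ (2 * k) *
        (derivative^[m + 2 * k] (scaledLegendre n μ)).eval (x : ℂ)) =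
        μ ^ n * (Complex.sin u * Complex.sinh v) ^ m * ∑ k ∈ Finset.range (n + 1),
        axialCoeff m k * ((1 - Complex.cos u ^ 2) * (Complex.cosh v ^ 2 - 1)) ^ k *
          (derivative^[m + 2 * k] (scaledLegendre n 1)).eval (Complex.cos u * Complex.cosh v) := by
      rw [Finset.mul_sum, Finset.mul_sum]
      refine Finset.sum_congr rfl fun k _ => ?_
      have h3 := eval_iterate_derivative_scaledLegendre n (m + 2 * k) h0
        (Complex.cos u * Complex.cosh v)
      have h4 : (1 - Complex.cos u ^ 2) * (Complex.cosh v ^ 2 - 1)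
          = (Complex.sin u * Complex.sinh v) ^ 2 := by
        rw [mul_pow, Complex.sinh_sq, Complex.sin_sq]
      rw [h4, h1, mul_assoc μ, hr, mul_pow μ, mul_pow μ, pow_mul (Complex.sin u * Complex.sinh v)]
      rw [pow_add] at h3
      linear_combination (Complex.sin u * Complex.sinh v) ^ m * axialCoeff m k *
        ((Complex.sin u * Complex.sinh v) ^ 2) ^ k * h3
    rw [axisConstant, mul_assoc _ ((ρ : ℂ) ^ m), hsum]
    change _ / (2 ^ n * halfPochhammer n) * _ * _ * _ = _
    rw [mul_pow]
    linear_combination ((n - m).factorial : ℂ) / (2 ^ n * halfPochhammer n) * μ ^ n * (-1) ^ m *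
      Complex.sin u ^ m * Complex.sinh v ^ m * key

/-! ### Connection between Gegenbauer polynomials of different scales -/

theorem natCast_factorial_ne_zero (n : ℕ) : (n.factorial : ℂ) ≠ 0 := by
  exact_mod_cast n.factorial_ne_zero

/-- Partial sums of the orthogonality relation below. -/
theorem sum_orthogonality_partial (d e i : ℕ) :
    ∑ l ∈ Finset.range (i + 1), (-1 : ℂ) ^ (i + e + 1 - l) *
        ((2 * (i + e + 1) + d : ℕ) - 2 * l + 3 / 2) * halfPochhammer (i + e + 1 + d + 1 - l) /
        ((l.factorial : ℂ) * ((i + e + 1 - l).factorial : ℂ) *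
          halfPochhammer (2 * (i + e + 1) + d + 2 - l))
      = (-1) ^ (e + 1) * halfPochhammer (e + d + 2) /
        ((i.factorial : ℂ) * (e.factorial : ℂ) * ((i + e + 1 : ℕ) : ℂ) *
          halfPochhammer (i + 2 * e + d + 3)) := by
  induction i generalizing e with
  | zero =>
    simp only [zero_add, Finset.sum_range_one, Nat.sub_zero, Nat.factorial_zero, Nat.factorial_succ]
    rw [show 2 * (e + 1) + d + 2 = 2 * e + d + 3 + 1 by ring, halfPochhammer_succ (2 * e + d + 3),
      show e + 1 + d + 1 = e + d + 2 by ring]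
    have f1 := natCast_factorial_ne_zero e
    have f2 := halfPochhammer_ne_zero (2 * e + d + 3)
    have f3 := natCast_add_half_ne_zero (2 * e + d + 3)
    have f4 : (e + 1 : ℂ) ≠ 0 := by exact_mod_cast e.succ_ne_zero
    generalize halfPochhammer (2 * e + d + 3) = p at *
    push_cast at f3 ⊢
    rw [one_div] at f3
    rw [div_eq_div_iff (by simp [*]) (by simp [*])]
    ring
  | succ i ih =>
    -- The full sum has upper index `q = i + e + 1` and parameter `M = 2q + d`. Using the hypothesis
    -- at `e + 1` keeps both fixed while `i` grows.
    have h := ih (e + 1)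
    rw [show i + (e + 1) + 1 = i + 1 + e + 1 by ring] at h
    rw [Finset.sum_range_succ, h, show i + 1 + e + 1 - (i + 1) = e + 1 by omega,
      show i + 1 + e + 1 + d + 1 - (i + 1) = e + d + 2 by omega,
      show 2 * (i + 1 + e + 1) + d + 2 - (i + 1) = i + 1 + 2 * e + d + 3 + 1 by omega,
      show i + 2 * (e + 1) + d + 3 = i + 1 + 2 * e + d + 3 + 1 by ring,
      show e + 1 + d + 2 = e + d + 2 + 1 by ring, halfPochhammer_succ (e + d + 2),
      halfPochhammer_succ (i + 1 + 2 * e + d + 3), Nat.factorial_succ, Nat.factorial_succ]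
    have f0 := natCast_factorial_ne_zero i
    have f1 := natCast_factorial_ne_zero e
    have f2 := halfPochhammer_ne_zero (i + 1 + 2 * e + d + 3)
    have f3 := natCast_add_half_ne_zero (i + 1 + 2 * e + d + 3)
    have f4 : (e + 1 : ℂ) ≠ 0 := by exact_mod_cast e.succ_ne_zero
    have f5 : (i + 1 : ℂ) ≠ 0 := by exact_mod_cast i.succ_ne_zero
    have f6 : (i + 1 + e + 1 : ℂ) ≠ 0 := by exact_mod_cast (i + 1 + e).succ_ne_zero
    generalize halfPochhammer (i + 1 + 2 * e + d + 3) = p at *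
    generalize halfPochhammer (e + d + 2) = p' at *
    push_cast at f3 ⊢
    rw [one_div] at f3
    rw [pow_succ]
    rw [div_add_div _ _ (by simp [*]) (by simp [*]), div_eq_div_iff (by simp [*]) (by simp [*])]
    ring

/-- This says that the monomial and Gegenbauer expansions invert each other. For `q > 0` the closed
form of the sum over `l < q` is the negative of the term `l = q`. -/
theorem sum_orthogonality (M q : ℕ) (h : 2 * q ≤ M) :
    ∑ l ∈ Finset.range (q + 1), (-1 : ℂ) ^ (q - l) * (M - 2 * l + 3 / 2) *
        halfPochhammer (M + 1 - q - l) /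
        ((l.factorial : ℂ) * ((q - l).factorial : ℂ) * halfPochhammer (M + 2 - l))
      = if q = 0 then 1 else 0 := by
  obtain ⟨d, rfl⟩ := Nat.exists_eq_add_of_le h
  rcases q with _ | q
  · have f1 := halfPochhammer_ne_zero (d + 1)
    have f2 := natCast_add_half_ne_zero (d + 1)
    have : (d + 3 / 2 : ℂ) = (d + 1 : ℕ) + 1 / 2 := by push_cast; ring
    simp only [zero_add, Finset.sum_range_one, mul_zero, Nat.sub_zero, halfPochhammer_succ (d + 1),
      if_true, pow_zero, Nat.factorial_zero, Nat.cast_zero, sub_zero, Nat.cast_one, one_mul]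
    rw [this, mul_comm]
    exact div_self (mul_ne_zero f1 f2)
  · have h := sum_orthogonality_partial d 0 q
    rw [Finset.sum_range_succ, if_neg q.succ_ne_zero]
    simp only [add_zero] at h
    have e : 2 * (q + 1) + d + 1 - (q + 1) = q + 1 + d + 1 := by omega
    rw [e, h, show q + 1 + d + 1 - (q + 1) = d + 1 by omega,
      show 2 * (q + 1) + d + 2 - (q + 1) = q + d + 3 by omega, Nat.sub_self, mul_zero, add_zero,
      zero_add, show 0 + d + 2 = d + 1 + 1 by ring, halfPochhammer_succ (d + 1)]
    have f0 := natCast_factorial_ne_zero q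
    have f2 := halfPochhammer_ne_zero (q + d + 3)
    have f5 : (q + 1 : ℂ) ≠ 0 := by exact_mod_cast q.succ_ne_zero
    rw [Nat.factorial_succ]
    push_cast
    field_simp
    ring

/-- The derivative of the scaled Legendre polynomial of degree `n + 1`, divided by `2^(n+1)`. -/
def scaledGegenbauer (n : ℕ) (μ : ℂ) : ℂ[X] :=
  ∑ i ∈ Finset.range (n / 2 + 1), C ((-(μ ^ 2 / 4)) ^ i * halfPochhammer (n + 1 - i) /
    ((i.factorial : ℂ) * ((n - 2 * i).factorial : ℂ))) * X ^ (n - 2 * i)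

/-- Expand `(X² - μ²)^(n+1)` binomially and differentiate `n + 2` times: exactly the terms with `2i
≤ n` survive, and `(2N)! = 4^N N! (1/2)_N` turns the factorials into Pochhammer symbols. -/
theorem derivative_scaledLegendre (n : ℕ) (μ : ℂ) :
    derivative (scaledLegendre (n + 1) μ) = C (2 ^ (n + 1)) * scaledGegenbauer n μ := by
  rw [scaledLegendre, derivative_C_mul, ← Function.iterate_succ_apply' (derivative (R := ℂ)),
    sub_eq_neg_add, add_pow, iterate_derivative_sum, scaledGegenbauer, Finset.mul_sum,
    Finset.mul_sum]
  symm
  have hsub : Finset.range (n / 2 + 1) ⊆ Finset.range (n + 1 + 1) :=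
    Finset.range_subset_range.2 (by omega)
  have e : ∀ i, (-C (μ ^ 2)) ^ i * (X ^ 2) ^ (n + 1 - i) * (((n + 1).choose i : ℕ) : ℂ[X])
      = C ((-(μ ^ 2)) ^ i * ((n + 1).choose i : ℂ)) * X ^ (2 * (n + 1 - i)) := by
    intro i
    rw [← pow_mul, ← C_neg, ← C_pow, ← C_eq_natCast, C_mul]
    ring
  simp only [e]
  simp only [iterate_derivative_C_mul, iterate_derivative_X_pow_eq_natCast_mul, ← C_eq_natCast]
  refine Finset.sum_subset_zero_on_sdiff hsub ?_ ?_
  · intro i hi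
    rw [Finset.mem_sdiff, Finset.mem_range, Finset.mem_range] at hi
    rw [Nat.descFactorial_eq_zero_iff_lt.2 (by omega)]
    simp
  · intro i hi
    rw [Finset.mem_range] at hi
    rw [show 2 * (n + 1 - i) - (n + 1).succ = n - 2 * i by omega]
    simp only [← mul_assoc, ← C_mul]
    congr 2
    have h1 : ((n - 2 * i).factorial : ℂ) * ((2 * (n + 1 - i)).descFactorial (n + 1).succ : ℂ)
        = 4 ^ (n + 1 - i) * (n + 1 - i).factorial * halfPochhammer (n + 1 - i) := by
      have h := Nat.factorial_mul_descFactorial (show (n + 1).succ ≤ 2 * (n + 1 - i) by omega)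
      rw [show 2 * (n + 1 - i) - (n + 1).succ = n - 2 * i by omega] at h
      rw [← factorial_two_mul]
      exact_mod_cast h
    have h2 : ((n + 1).choose i : ℂ) * i.factorial * (n + 1 - i).factorial = (n + 1).factorial := by
      exact_mod_cast Nat.choose_mul_factorial_mul_factorial (show i ≤ n + 1 by omega)
    have h3 : (4 : ℂ) ^ (n + 1 - i) * 4 ^ i = 2 ^ (n + 1) * 2 ^ (n + 1) := by
      rw [← pow_add, Nat.sub_add_cancel (by omega), ← mul_pow]; norm_num
    have f0 := natCast_factorial_ne_zero i
    have f1 := natCast_factorial_ne_zero (n + 1)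
    have f2 := natCast_factorial_ne_zero (n - 2 * i)
    have f3 := natCast_factorial_ne_zero (n + 1 - i)
    have h4 : (-(μ ^ 2 / 4)) ^ i = (-(μ ^ 2)) ^ i / 4 ^ i := by rw [← div_pow]; ring
    rw [h4]
    generalize (-(μ ^ 2)) ^ i = s
    generalize halfPochhammer (n + 1 - i) = p at *
    generalize ((2 * (n + 1 - i)).descFactorial (n + 1).succ : ℂ) = D at *
    rw [← h2] at f1 ⊢
    have f4 : ((n + 1).choose i : ℂ) ≠ 0 := by
      intro h; simp [h] at f1
    have f5 : (4 : ℂ) ^ i ≠ 0 := by norm_num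
    have f6 : (2 : ℂ) ^ (n + 1) ≠ 0 := by norm_num
    generalize (2 : ℂ) ^ (n + 1) = t at *
    generalize (4 : ℂ) ^ i = r at *
    generalize (4 : ℂ) ^ (n + 1 - i) = r' at *
    have h5 : D = r' * (n + 1 - i).factorial * p / (n - 2 * i).factorial := by
      rw [eq_div_iff f2, ← h1]; ring
    have h6 : r' = t * t / r := by rw [eq_div_iff f5, h3]
    rw [h5, h6]
    field_simp

/-- Inserting the definition of the Gegenbauer polynomials and collecting the terms with `l + i =
q`, the coefficient of `X^(M-2q)` is an orthogonality sum, so only `q = 0` remains. -/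
theorem C_mul_X_pow_eq_sum_scaledGegenbauer (M : ℕ) (μ : ℂ) :
    C (1 / (M.factorial : ℂ)) * X ^ M = ∑ l ∈ Finset.range (M / 2 + 1),
      C ((μ ^ 2 / 4) ^ l * (M - 2 * l + 3 / 2) / ((l.factorial : ℂ) * halfPochhammer (M + 2 - l))) *
        scaledGegenbauer (M - 2 * l) μ := by
  let f : ℕ → ℕ → ℂ[X] := fun l i =>
    C ((μ ^ 2 / 4) ^ l * (M - 2 * l + 3 / 2) / ((l.factorial : ℂ) * halfPochhammer (M + 2 - l))) *
      (C ((-(μ ^ 2 / 4)) ^ i * halfPochhammer (M - 2 * l + 1 - i) /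
      ((i.factorial : ℂ) * ((M - 2 * l - 2 * i).factorial : ℂ))) * X ^ (M - 2 * l - 2 * i))
  have h1 : ∀ l ∈ Finset.range (M / 2 + 1),
      C ((μ ^ 2 / 4) ^ l * (M - 2 * l + 3 / 2) / ((l.factorial : ℂ) * halfPochhammer (M + 2 - l))) *
        scaledGegenbauer (M - 2 * l) μ = ∑ i ∈ Finset.range (M / 2 + 1 - l), f l i := by
    intro l hl
    rw [Finset.mem_range] at hl
    rw [scaledGegenbauer, Finset.mul_sum, show (M - 2 * l) / 2 + 1 = M / 2 + 1 - l by omega]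
  rw [Finset.sum_congr rfl h1, ← Finset.sum_range_diag_flip]
  have h2 : ∀ q ∈ Finset.range (M / 2 + 1), ∑ l ∈ Finset.range (q + 1), f l (q - l)
      = C ((μ ^ 2 / 4) ^ q / ((M - 2 * q).factorial : ℂ) * if q = 0 then 1 else 0) *
        X ^ (M - 2 * q) := by
    intro q hq
    rw [Finset.mem_range] at hq
    rw [← sum_orthogonality M q (by omega), Finset.mul_sum, map_sum, Finset.sum_mul]
    refine Finset.sum_congr rfl fun l hl => ?_
    rw [Finset.mem_range] at hl
    simp only [f]
    rw [show M - 2 * l - 2 * (q - l) = M - 2 * q by omega,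
      show M - 2 * l + 1 - (q - l) = M + 1 - q - l by omega, ← mul_assoc, ← C_mul]
    congr 2
    have h3 : (μ ^ 2 / 4) ^ q = (μ ^ 2 / 4) ^ l * (μ ^ 2 / 4) ^ (q - l) := by
      rw [← pow_add, Nat.add_sub_cancel' (by omega)]
    rw [h3, neg_pow (μ ^ 2 / 4) (q - l), div_mul_div_comm, div_mul_div_comm]
    congr 1 <;> ring
  rw [Finset.sum_congr rfl h2, Finset.sum_range_succ', Finset.sum_eq_zero]
  · simp
  · intro q _
    simp

/-- The connection coefficients of the scaled Gegenbauer polynomials. -/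
def connectionCoeff (n k : ℕ) (μ' μ : ℂ) : ℂ :=
  ∑ j ∈ Finset.range (k + 1), (-(μ' ^ 2 / 4)) ^ j * halfPochhammer (n + 1 - j) / (j.factorial : ℂ) *
    ((μ ^ 2 / 4) ^ (k - j) * (n - 2 * k + 3 / 2) /
      (((k - j).factorial : ℂ) * halfPochhammer (n + 2 - k - j)))

/-- Each monomial of the polynomial of scale `μ'` is re-expanded in those of scale `μ`; the terms
with `j + l = k` make up the `k`-th coefficient. The case `μ = 0` is not excluded here. -/
theorem scaledGegenbauer_connection (n : ℕ) (μ' μ : ℂ) :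
    scaledGegenbauer n μ' = ∑ k ∈ Finset.range (n / 2 + 1),
      C (connectionCoeff n k μ' μ) * scaledGegenbauer (n - 2 * k) μ := by
  let f : ℕ → ℕ → ℂ[X] := fun j l =>
    C ((-(μ' ^ 2 / 4)) ^ j * halfPochhammer (n + 1 - j) / (j.factorial : ℂ)) *
      (C ((μ ^ 2 / 4) ^ l * ((n - 2 * j : ℕ) - 2 * l + 3 / 2) /
        ((l.factorial : ℂ) * halfPochhammer (n - 2 * j + 2 - l))) *
        scaledGegenbauer (n - 2 * j - 2 * l) μ)
  have h1 : scaledGegenbauer n μ' = ∑ j ∈ Finset.range (n / 2 + 1),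
      ∑ l ∈ Finset.range (n / 2 + 1 - j), f j l := by
    rw [scaledGegenbauer]
    refine Finset.sum_congr rfl fun j hj => ?_
    rw [Finset.mem_range] at hj
    simp only [f]
    rw [← Finset.mul_sum, show n / 2 + 1 - j = (n - 2 * j) / 2 + 1 by omega,
      ← C_mul_X_pow_eq_sum_scaledGegenbauer, ← mul_assoc, ← C_mul]
    congr 2
    rw [div_mul_div_comm, mul_one]
  rw [h1, ← Finset.sum_range_diag_flip]
  refine Finset.sum_congr rfl fun k hk => ?_
  rw [Finset.mem_range] at hk
  rw [connectionCoeff, map_sum, Finset.sum_mul]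
  refine Finset.sum_congr rfl fun j hj => ?_
  rw [Finset.mem_range] at hj
  simp only [f]
  rw [← mul_assoc, ← C_mul, show n - 2 * j - 2 * (k - j) = n - 2 * k by omega,
    show n - 2 * j + 2 - (k - j) = n + 2 - k - j by omega]
  have : (((n - 2 * j : ℕ) : ℂ) - 2 * ((k - j : ℕ) : ℂ)) = n - 2 * k := by
    rw [Nat.cast_sub (by omega), Nat.cast_sub (by omega)]
    push_cast
    ring
  rw [this]

/-! ### The connection coefficient as a terminating hypergeometric series -/

theorem ascPochhammer_eval_neg_natCast {j k : ℕ} (h : j ≤ k) :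
    (ascPochhammer ℂ j).eval (-(k : ℂ)) = (-1) ^ j * (k.factorial : ℂ) / ((k - j).factorial : ℂ) := by
  induction j with
  | zero => simp [div_self (natCast_factorial_ne_zero k)]
  | succ j ih =>
    have f := natCast_factorial_ne_zero (k - (j + 1))
    obtain ⟨d, rfl⟩ := Nat.exists_eq_add_of_le h
    rw [ascPochhammer_succ_eval, ih (by omega), show j + 1 + d - j = d + 1 by omega,
      Nat.factorial_succ]
    rw [show j + 1 + d - (j + 1) = d by omega] at f ⊢
    have f4 : (d + 1 : ℂ) ≠ 0 := by exact_mod_cast d.succ_ne_zero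
    push_cast
    field_simp
    ring

theorem ascPochhammer_eval_neg_natCast_add_half {j M : ℕ} (h : j ≤ M) :
    (ascPochhammer ℂ j).eval (-(M : ℂ) + 1 / 2)
      = (-1) ^ j * halfPochhammer M / halfPochhammer (M - j) := by
  induction j with
  | zero => simp [halfPochhammer_ne_zero]
  | succ j ih =>
    obtain ⟨d, rfl⟩ := Nat.exists_eq_add_of_le h
    rw [ascPochhammer_succ_eval, ih (by omega), show j + 1 + d - j = d + 1 by omega,
      halfPochhammer_succ d, show j + 1 + d - (j + 1) = d by omega]
    have f := halfPochhammer_ne_zero d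
    have f4 := natCast_add_half_ne_zero d
    rw [div_mul_eq_mul_div, div_eq_div_iff (mul_ne_zero f f4) f]
    push_cast
    ring

theorem ordinaryHypergeometric_neg_natCast (k : ℕ) (b c z : ℂ) :
    ordinaryHypergeometric (-(k : ℂ)) b c z = ∑ j ∈ Finset.range (k + 1),
      ((j.factorial : ℂ)⁻¹ * (ascPochhammer ℂ j).eval (-(k : ℂ)) * (ascPochhammer ℂ j).eval b *
        ((ascPochhammer ℂ j).eval c)⁻¹) * z ^ j := by
  rw [ordinaryHypergeometric_eq_tsum]
  simp only [smul_eq_mul]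
  apply tsum_eq_sum
  intro j hj
  rw [Finset.mem_range, not_lt] at hj
  rw [(ascPochhammer_eval_eq_zero_iff j _).2 ⟨k, by omega, by simp⟩]
  simp

/-- The sums agree term by term. The lower and second upper parameters have the form `-M + 1/2` with
`M = n + 1` and `M = n + 2 - k`, so their Pochhammer symbols are quotients of values `(1/2)_M /
(1/2)_(M-j)` up to sign. -/
theorem ordinaryHypergeometric_eq_connectionCoeff {n k : ℕ} (h : 2 * k ≤ n) (μ' : ℂ) {μ : ℂ}
    (hμ : μ ≠ 0) :
    ordinaryHypergeometric (-(k : ℂ)) (-(n : ℂ) + k - 3 / 2) (-(n : ℂ) - 1 / 2) ((μ' / μ) ^ 2) *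
      (halfPochhammer (n + 1) * (n - 2 * k + 3 / 2) * μ ^ (2 * k))
      = connectionCoeff n k μ' μ * (4 ^ k * (k.factorial : ℂ) * halfPochhammer (n + 2 - k)) := by
  rw [ordinaryHypergeometric_neg_natCast, connectionCoeff, Finset.sum_mul, Finset.sum_mul]
  refine Finset.sum_congr rfl fun j hj => ?_
  rw [Finset.mem_range] at hj
  have hb : (-(n : ℂ) + k - 3 / 2) = -((n + 2 - k : ℕ) : ℂ) + 1 / 2 := by
    rw [Nat.cast_sub (by omega)]; push_cast; ring
  have hc : (-(n : ℂ) - 1 / 2) = -((n + 1 : ℕ) : ℂ) + 1 / 2 := by push_cast; ring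
  rw [hb, hc, ascPochhammer_eval_neg_natCast (by omega),
    ascPochhammer_eval_neg_natCast_add_half (by omega),
    ascPochhammer_eval_neg_natCast_add_half (by omega)]
  have hμk : μ ^ (2 * k) = (μ ^ 2) ^ j * (μ ^ 2) ^ (k - j) := by
    rw [← pow_add, Nat.add_sub_cancel' (by omega), pow_mul]
  have h4k : (4 : ℂ) ^ k = 4 ^ j * 4 ^ (k - j) := by
    rw [← pow_add, Nat.add_sub_cancel' (by omega)]
  have hs : ((-1 : ℂ) ^ j) * (-1) ^ j = 1 := by rw [← mul_pow]; simp
  have f0 := natCast_factorial_ne_zero j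
  have f1 := natCast_factorial_ne_zero (k - j)
  have f2 := halfPochhammer_ne_zero (n + 1)
  have f3 := halfPochhammer_ne_zero (n + 1 - j)
  have f4 := halfPochhammer_ne_zero (n + 2 - k - j)
  have f5 : (μ ^ 2) ^ j ≠ 0 := pow_ne_zero _ (pow_ne_zero _ hμ)
  have f6 : (4 : ℂ) ^ j ≠ 0 := by norm_num
  have f7 : (4 : ℂ) ^ (k - j) ≠ 0 := by norm_num
  have f8 : (-1 : ℂ) ^ j ≠ 0 := by simp
  rw [hμk, h4k, neg_pow (μ' ^ 2 / 4) j, div_pow (μ' ^ 2), div_pow (μ ^ 2) 4, div_pow μ',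
    div_pow (μ' ^ 2)]
  generalize (-1 : ℂ) ^ j = s at *
  generalize (μ ^ 2) ^ j = t at *
  generalize (μ ^ 2) ^ (k - j) = t1 at *
  generalize (4 : ℂ) ^ j = t2 at *
  generalize (4 : ℂ) ^ (k - j) = t3 at *
  generalize (n - 2 * k + 3 / 2 : ℂ) = t4 at *
  field_simp

/-! ### Connection and independence on the axis -/

theorem axisConstant_eq {n m : ℕ} (h : m ≤ n) :
    axisConstant n m * 2 ^ n = (-1) ^ m * ((n + m).factorial : ℂ) /
      (2 ^ m * (m.factorial : ℂ) * halfPochhammer n) := by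
  rw [axisConstant, eval_one_iterate_derivative n m h]
  have f0 := natCast_factorial_ne_zero m
  have f1 := natCast_factorial_ne_zero (n - m)
  have f2 := halfPochhammer_ne_zero n
  field_simp

theorem axisConstant_ne_zero {n m : ℕ} (h : m ≤ n) : axisConstant n m ≠ 0 := by
  have h1 := axisConstant_eq h
  have h2 : (-1 : ℂ) ^ m * ((n + m).factorial : ℂ) /
      (2 ^ m * (m.factorial : ℂ) * halfPochhammer n) ≠ 0 := by
    simp [halfPochhammer_ne_zero, Nat.factorial_ne_zero]
  rw [← h1] at h2
  exact left_ne_zero_of_mul h2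

/-- The restriction of `V_{n,m}[μ] / ρ^m` to the axis. -/
def axisPolynomial (n m : ℕ) (μ : ℂ) : ℂ[X] :=
  C (axisConstant (n + 1) m) * derivative^[m + 1] (scaledLegendre (n + 1) μ)

theorem axisPolynomial_eq (n m : ℕ) (μ : ℂ) :
    axisPolynomial n m μ
      = C (axisConstant (n + 1) m * 2 ^ (n + 1)) * derivative^[m] (scaledGegenbauer n μ) := by
  rw [axisPolynomial, Function.iterate_succ_apply, derivative_scaledLegendre,
    iterate_derivative_C_mul, C_mul, mul_assoc]

/-- The conversion coefficient is the Gegenbauer connection coefficient times the ratio of the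
normalising constants of `V_{n,m}` and `V_{n-2k,m}`; this ratio supplies the factorials containing
`m`. -/
theorem conversionCoeff_mul {n m k : ℕ} (h : m ≤ n) (hk : 2 * k ≤ n - m) (μ' : ℂ) {μ : ℂ}
    (hμ : μ ≠ 0) :
    conversionCoeff n m k μ' μ * (axisConstant (n - 2 * k + 1) m * 2 ^ (n - 2 * k + 1))
      = axisConstant (n + 1) m * 2 ^ (n + 1) * connectionCoeff n k μ' μ := by
  have key := ordinaryHypergeometric_eq_connectionCoeff (show 2 * k ≤ n by omega) μ' hμ
  rw [axisConstant_eq (by omega), axisConstant_eq (by omega), conversionCoeff, conversionConstant]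
  change _ * (_ * halfPochhammer _ / (_ * halfPochhammer _)) * _ * _ = _
  rw [show n - k + 2 = n + 2 - k by omega, show n - 2 * k + 2 = n - 2 * k + 1 + 1 by ring,
    halfPochhammer_succ, show n + m - 2 * k + 1 = n - 2 * k + 1 + m by omega,
    show n + m + 1 = n + 1 + m by ring]
  have hc : (((n - 2 * k + 1 : ℕ) : ℂ) + 1 / 2) = n - 2 * k + 3 / 2 := by
    push_cast [Nat.cast_sub (show 2 * k ≤ n by omega)]; ring
  rw [hc]
  have f0 := natCast_factorial_ne_zero m
  have f1 := natCast_factorial_ne_zero k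
  have f2 := natCast_factorial_ne_zero (n - 2 * k + 1 + m)
  have f3 := halfPochhammer_ne_zero (n + 1)
  have f4 := halfPochhammer_ne_zero (n - 2 * k + 1)
  have f5 := halfPochhammer_ne_zero (n + 2 - k)
  generalize ordinaryHypergeometric (-(k : ℂ)) (-(n : ℂ) + k - 3 / 2) (-(n : ℂ) - 1 / 2)
    ((μ' / μ) ^ 2) = F at *
  generalize (n - 2 * k + 3 / 2 : ℂ) = t at *
  field_simp
  linear_combination ((n + 1 + m).factorial : ℂ) * key

/-- Differentiate the Gegenbauer connection `m` times. The polynomials of degree `n - 2k < m`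
disappear, which cuts the range `2k ≤ n` down to `2k ≤ n - m`. -/
theorem axisPolynomial_connection {n m : ℕ} (h : m ≤ n) (μ' : ℂ) {μ : ℂ} (hμ : μ ≠ 0) :
    axisPolynomial n m μ' = ∑ k ∈ Finset.range (n + 1) with 2 * k ≤ n - m,
      C (conversionCoeff n m k μ' μ) * axisPolynomial (n - 2 * k) m μ := by
  rw [axisPolynomial_eq, scaledGegenbauer_connection n μ' μ, iterate_derivative_sum,
    Finset.mul_sum]
  symm
  apply Finset.sum_subset_zero_on_sdiff
  · intro k hk
    rw [Finset.mem_filter] at hk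
    rw [Finset.mem_range]
    omega
  · intro k hk
    simp only [Finset.mem_sdiff, Finset.mem_range, Finset.mem_filter] at hk
    rw [iterate_derivative_C_mul]
    have hz : C ((2 : ℂ) ^ (n - 2 * k + 1)) * derivative^[m] (scaledGegenbauer (n - 2 * k) μ)
        = 0 := by
      rw [← iterate_derivative_C_mul, ← derivative_scaledLegendre, ← Function.iterate_succ_apply]
      exact iterate_derivative_scaledLegendre_eq_zero (by omega) μ
    rw [(mul_eq_zero.1 hz).resolve_left (C_ne_zero.2 (by norm_num))]
    simp
  · intro k hk
    rw [Finset.mem_filter] at hk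
    rw [axisPolynomial_eq, iterate_derivative_C_mul, ← mul_assoc, ← mul_assoc, ← C_mul, ← C_mul,
      conversionCoeff_mul h hk.2 μ' hμ]

theorem natDegree_axisPolynomial_le (n m : ℕ) (μ : ℂ) :
    (axisPolynomial n m μ).natDegree ≤ n - m := by
  refine (natDegree_C_mul_le _ _).trans
    ((natDegree_iterate_derivative_scaledLegendre_le _ _ _).trans ?_)
  omega

theorem coeff_axisPolynomial_ne_zero {n m : ℕ} (h : m ≤ n) (μ : ℂ) :
    (axisPolynomial n m μ).coeff (n - m) ≠ 0 := by
  have h1 := coeff_iterate_derivative_scaledLegendre (show m + 1 ≤ n + 1 by omega) μ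
  rw [show n + 1 - (m + 1) = n - m by omega] at h1
  rw [axisPolynomial, coeff_C_mul, h1]
  refine mul_ne_zero (axisConstant_ne_zero (by omega)) ?_
  exact right_ne_zero_of_mul (ne_of_eq_of_ne
    (leadCoeff_normalization (show m + 1 ≤ n + 1 by omega)) one_ne_zero)

/-- The polynomials `V_{n-2k,m}[μ] / ρ^m` on the axis are linearly independent. -/
theorem eq_zero_of_sum_axisPolynomial_eq_zero {n m : ℕ} (h : m ≤ n) (μ : ℂ) (d : ℕ → ℂ)
    (hd : ∑ k ∈ Finset.range (n + 1) with 2 * k ≤ n - m,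
      C (d k) * axisPolynomial (n - 2 * k) m μ = 0) (k : ℕ) (hk : 2 * k ≤ n - m) : d k = 0 := by
  induction k using Nat.strong_induction_on with
  | _ k ih =>
    -- Take the coefficient at the top degree of the `k`-th polynomial: indices below `k` drop out
    -- by induction, indices above `k` by degree.
    have h1 := congrArg (fun p => coeff p (n - 2 * k - m)) hd
    simp only [finsetSum_coeff, coeff_C_mul, coeff_zero] at h1
    rw [Finset.sum_eq_single k] at h1
    · exact (mul_eq_zero.1 h1).resolve_right (coeff_axisPolynomial_ne_zero (by omega) μ)
    · intro j hj hne
      rw [Finset.mem_filter] at hj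
      rcases lt_or_gt_of_ne hne with hlt | hgt
      · rw [ih j hlt hj.2, zero_mul]
      · rw [coeff_eq_zero_of_natDegree_lt, mul_zero]
        exact (natDegree_axisPolynomial_le _ _ _).trans_lt (by omega)
    · intro hn
      refine absurd ?_ hn
      rw [Finset.mem_filter, Finset.mem_range]
      omega

/-! ### Extension off the axis and transfer of the connection -/

/-- The axially harmonic extension of a polynomial `p` off the axis, without the factor `ρ^m`. -/
def axialExtension (m K : ℕ) (x ρ : ℝ) : ℂ[X] →ₗ[ℂ] ℂ where
  toFun p := ∑ k ∈ Finset.range K, axialCoeff m k * ρ ^ (2 * k) * (derivative^[2 * k] p).eval (x : ℂ)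
  map_add' p q := by
    simp [iterate_map_add, mul_add, Finset.sum_add_distrib]
  map_smul' c p := by
    simp only [iterate_derivative_smul, eval_smul, smul_eq_mul, RingHom.id_apply, Finset.mul_sum]
    exact Finset.sum_congr rfl fun k _ => by ring

theorem axialExtension_apply (m K : ℕ) (x ρ : ℝ) (p : ℂ[X]) : axialExtension m K x ρ p
    = ∑ k ∈ Finset.range K, axialCoeff m k * ρ ^ (2 * k) * (derivative^[2 * k] p).eval (x : ℂ) :=
  rfl

theorem axialExtension_C_mul (m K : ℕ) (x ρ : ℝ) (c : ℂ) (p : ℂ[X]) :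
    axialExtension m K x ρ (C c * p) = c * axialExtension m K x ρ p := by
  rw [← smul_eq_C_mul, map_smul, smul_eq_mul]

/-- Differentiation in `x₀` commutes with the extension. The truncation `K` is left free, since
surplus terms vanish, so that all `V_{n-2k,m}` are images under one linear map. -/
theorem garabedianV_eq {n m K : ℕ} (h : m ≤ n) (hK : n + 2 ≤ K) {μ : ℂ}
    (hμ : IsSpheroidParameter μ) (x ρ : ℝ) (hρ : 0 ≤ ρ) :
    garabedianV n m μ x ρ = ρ ^ m * axialExtension m K x ρ (axisPolynomial n m μ) := by
  have hfun : (fun s : ℝ => harmonicU (n + 1) m μ s ρ) = fun s : ℝ =>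
      axisConstant (n + 1) m * ρ ^ m * ∑ k ∈ Finset.range (n + 1 + 1), axialCoeff m k *
        ρ ^ (2 * k) * (derivative^[m + 2 * k] (scaledLegendre (n + 1) μ)).eval (s : ℂ) :=
    funext fun s => harmonicU_eq_sum n.succ_ne_zero (by omega) hμ s ρ hρ
  have hder : HasDerivAt (fun s : ℝ =>
      axisConstant (n + 1) m * (ρ : ℂ) ^ m * ∑ k ∈ Finset.range (n + 1 + 1), axialCoeff m k *
        (ρ : ℂ) ^ (2 * k) * (derivative^[m + 2 * k] (scaledLegendre (n + 1) μ)).eval (s : ℂ))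
      (axisConstant (n + 1) m * (ρ : ℂ) ^ m * ∑ k ∈ Finset.range (n + 1 + 1), axialCoeff m k *
        (ρ : ℂ) ^ (2 * k) *
          (derivative (derivative^[m + 2 * k] (scaledLegendre (n + 1) μ))).eval (x : ℂ)) x := by
    refine HasDerivAt.const_mul _ (HasDerivAt.fun_sum fun k _ => HasDerivAt.const_mul _ ?_)
    exact (Polynomial.hasDerivAt _ _).comp_ofReal
  rw [garabedianV, hfun, hder.deriv, axisPolynomial, axialExtension_C_mul, axialExtension_apply,
    mul_comm (axisConstant (n + 1) m), mul_assoc]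
  congr 2
  have hsub : Finset.range (n + 1 + 1) ⊆ Finset.range K := Finset.range_subset_range.2 hK
  refine Finset.sum_subset_zero_on_sdiff hsub ?_ ?_
  · intro k hk
    rw [Finset.mem_sdiff, Finset.mem_range, Finset.mem_range] at hk
    rw [← Function.iterate_add_apply, iterate_derivative_scaledLegendre_eq_zero (by omega)]
    simp
  · intro k _
    rw [← Function.iterate_succ_apply' (derivative (R := ℂ)), ← Function.iterate_add_apply]
    congr 3
    omega

/-- The extension is continuous in `ρ` and tends to `p(x)` as `ρ → 0`, so vanishing off the axis
makes every real number a root of `p`. Assuming only `ρ > 0` permits prior division by `ρ^m`. -/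
theorem eq_zero_of_axialExtension_eq_zero {m K : ℕ} {p : ℂ[X]}
    (h : ∀ x ρ : ℝ, 0 < ρ → axialExtension m (K + 1) x ρ p = 0) : p = 0 := by
  have hx : ∀ x : ℝ, p.eval (x : ℂ) = 0 := by
    intro x
    have hcont : Continuous fun ρ : ℝ => axialExtension m (K + 1) x ρ p := by
      simp only [axialExtension_apply]
      fun_prop
    have hon : Set.EqOn (fun ρ : ℝ => axialExtension m (K + 1) x ρ p) (fun _ => 0)
        (Set.Ioi 0) := fun ρ hρ => h x ρ hρ
    have h0 := hon.closure hcont continuous_const (x := 0) (by simp)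
    simp only [axialExtension_apply] at h0
    rw [Finset.sum_range_succ', Finset.sum_eq_zero] at h0
    · simpa using h0
    · intro k _
      simp
  apply eq_zero_of_infinite_isRoot
  refine (Set.infinite_range_of_injective Complex.ofReal_injective).mono ?_
  rintro _ ⟨x, rfl⟩
  exact hx x

theorem garabedianV_connection {n m : ℕ} (h : m ≤ n) {μ' μ : ℂ} (hμ' : IsSpheroidParameter μ')
    (hμ : IsSpheroidParameter μ) (hμ0 : μ ≠ 0) (x ρ : ℝ) (hρ : 0 ≤ ρ) :
    garabedianV n m μ' x ρ = ∑ k ∈ Finset.range (n + 1) with 2 * k ≤ n - m,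
      conversionCoeff n m k μ' μ * garabedianV (n - 2 * k) m μ x ρ := by
  rw [garabedianV_eq h le_rfl hμ' x ρ hρ, axisPolynomial_connection h μ' hμ0, map_sum,
    Finset.mul_sum]
  refine Finset.sum_congr rfl fun k hk => ?_
  rw [Finset.mem_filter] at hk
  rw [axialExtension_C_mul, garabedianV_eq (K := n + 2) (by omega) (by omega) hμ x ρ hρ]
  ring

theorem eq_conversionCoeff_of_garabedianV {n m : ℕ} (h : m ≤ n) {μ' μ : ℂ}
    (hμ' : IsSpheroidParameter μ') (hμ : IsSpheroidParameter μ) (hμ0 : μ ≠ 0) {c : ℕ → ℂ}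
    (hc : ∀ x ρ : ℝ, 0 < ρ → garabedianV n m μ' x ρ =
      ∑ k ∈ Finset.range (n + 1) with 2 * k ≤ n - m, c k * garabedianV (n - 2 * k) m μ x ρ)
    (k : ℕ) (hk : 2 * k ≤ n - m) : c k = conversionCoeff n m k μ' μ := by
  rw [← sub_eq_zero]
  refine eq_zero_of_sum_axisPolynomial_eq_zero h μ
    (fun k => c k - conversionCoeff n m k μ' μ) ?_ k hk
  apply eq_zero_of_axialExtension_eq_zero (m := m) (K := n + 1)
  intro x ρ hρ
  have h1 := hc x ρ hρ
  rw [garabedianV_connection h hμ' hμ hμ0 x ρ hρ.le, ← sub_eq_zero,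
    ← Finset.sum_sub_distrib] at h1
  have hρm : (ρ : ℂ) ^ m ≠ 0 := pow_ne_zero _ (by exact_mod_cast hρ.ne')
  apply (mul_eq_zero.1 (?_ : (ρ : ℂ) ^ m * _ = 0)).resolve_left hρm
  rw [map_sum, Finset.mul_sum, ← neg_eq_zero, ← h1, ← Finset.sum_neg_distrib]
  refine Finset.sum_congr rfl fun k hk => ?_
  rw [Finset.mem_filter] at hk
  rw [axialExtension_C_mul, garabedianV_eq (K := n + 1 + 1) (by omega) (by omega) hμ x ρ hρ.le]
  ring

/-- On some half-plane through the axis the angular factor is nonzero. -/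
theorem exists_angular_ne_zero (sign : Bool) (m : ℕ) (h : sign = false → 1 ≤ m) (ρ : ℝ)
    (hρ : 0 < ρ) : ∃ x₁ x₂ : ℝ, √(x₁ ^ 2 + x₂ ^ 2) = ρ ∧
      angular sign m (Complex.arg ⟨x₁, x₂⟩) ≠ 0 := by
  cases sign with
  | true =>
    refine ⟨ρ, 0, by simp [Real.sqrt_sq hρ.le], ?_⟩
    have : Complex.arg ⟨ρ, 0⟩ = 0 := Complex.arg_ofReal_of_nonneg hρ.le
    simp [this, angular]
  | false =>
    have hm : (1 : ℝ) ≤ m := by exact_mod_cast h rfl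
    have hm0 : (0 : ℝ) < m := by linarith
    have hπ := Real.pi_pos
    -- The choice makes `mφ = π/2`, where the sine is 1; `m ≥ 1` keeps `φ` in the range of the
    -- principal argument.
    set φ : ℝ := Real.pi / 2 / m with hφ
    have hmφ : m * φ = Real.pi / 2 := by rw [hφ]; field_simp
    have hφ0 : 0 < φ := by positivity
    have hφ1 : φ ≤ Real.pi := by nlinarith
    refine ⟨ρ * Real.cos φ, ρ * Real.sin φ, ?_, ?_⟩
    · rw [show (ρ * Real.cos φ) ^ 2 + (ρ * Real.sin φ) ^ 2 = ρ ^ 2 by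
        linear_combination ρ ^ 2 * Real.sin_sq_add_cos_sq φ, Real.sqrt_sq hρ.le]
    · have e : (⟨ρ * Real.cos φ, ρ * Real.sin φ⟩ : ℂ)
          = ρ * (Complex.cos φ + Complex.sin φ * Complex.I) := by
        rw [← Complex.ofReal_cos, ← Complex.ofReal_sin]
        apply Complex.ext <;> simp [-Complex.ofReal_cos, -Complex.ofReal_sin]
      rw [e, Complex.arg_mul_cos_add_sin_mul_I hρ ⟨by linarith, hφ1⟩]
      simp [angular, hmφ]

end SpheroidalHarmonics

end

/-! ### The conversion theorem -/

theorem mainTheorem4 (n m : ℕ) (hmn : m ≤ n) (μ' μ : ℂ)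
    (hμ' : SpheroidalHarmonics.IsSpheroidParameter μ')
    (hμ : SpheroidalHarmonics.IsSpheroidParameter μ) (hμ0 : μ ≠ 0) (c : ℕ → ℂ) :
    ((∀ x₀ ρ : ℝ, 0 ≤ ρ →
        SpheroidalHarmonics.garabedianV n m μ' x₀ ρ =
          ∑ k ∈ Finset.range (n + 1) with 2 * k ≤ n - m,
            c k * SpheroidalHarmonics.garabedianV (n - 2 * k) m μ x₀ ρ) ↔
      ∀ k : ℕ, 2 * k ≤ n - m → c k = SpheroidalHarmonics.conversionCoeff n m k μ' μ) ∧
    (∀ sign : Bool, (sign = false → 1 ≤ m) →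
      ((∀ x₀ x₁ x₂ : ℝ,
          SpheroidalHarmonics.solidV sign n m μ' x₀ x₁ x₂ =
            ∑ k ∈ Finset.range (n + 1) with 2 * k ≤ n - m,
              c k * SpheroidalHarmonics.solidV sign (n - 2 * k) m μ x₀ x₁ x₂) ↔
        ∀ k : ℕ, 2 * k ≤ n - m → c k = SpheroidalHarmonics.conversionCoeff n m k μ' μ)) := by
  have expand : (∀ k : ℕ, 2 * k ≤ n - m → c k = SpheroidalHarmonics.conversionCoeff n m k μ' μ) →
      ∀ x₀ ρ : ℝ, 0 ≤ ρ → SpheroidalHarmonics.garabedianV n m μ' x₀ ρ =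
        ∑ k ∈ Finset.range (n + 1) with 2 * k ≤ n - m,
          c k * SpheroidalHarmonics.garabedianV (n - 2 * k) m μ x₀ ρ := by
    intro hc x₀ ρ hρ
    rw [SpheroidalHarmonics.garabedianV_connection hmn hμ' hμ hμ0 x₀ ρ hρ]
    refine Finset.sum_congr rfl fun k hk => ?_
    rw [hc k (Finset.mem_filter.1 hk).2]
  have unique := fun hc => SpheroidalHarmonics.eq_conversionCoeff_of_garabedianV hmn hμ' hμ hμ0
    (c := c) hc
  refine ⟨⟨fun hc => unique fun x ρ hρ => hc x ρ hρ.le, expand⟩, fun sign hsign => ⟨?_, ?_⟩⟩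
  · refine fun hc => unique fun x ρ hρ => ?_
    -- The angular factor is common to all terms and can be cancelled on a half-plane where it is
    -- nonzero. That half-plane contains points at every distance `ρ > 0` from the axis, which is
    -- all that uniqueness needs.
    obtain ⟨x₁, x₂, hr, ha⟩ := SpheroidalHarmonics.exists_angular_ne_zero sign m hsign ρ hρ
    have h := hc x x₁ x₂
    simp only [SpheroidalHarmonics.solidV_eq_garabedianV_mul_angular, hr, ← mul_assoc] at h
    rw [← Finset.sum_mul] at h
    exact mul_right_cancel₀ (Complex.ofReal_ne_zero.2 ha) h
  · intro hc x₀ x₁ x₂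
    simp only [SpheroidalHarmonics.solidV_eq_garabedianV_mul_angular, ← mul_assoc]
    rw [← Finset.sum_mul, expand hc x₀ _ (Real.sqrt_nonneg _)]
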